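/- There is a universal constant $C>0$ such that the following holds. Let $n,s\in\mathbb{N}$, let $R,\beta_1,\alpha_2,\epsilon>0$, put $\mathcal{K}=\{x\in\mathbb{R}^n:\Vert x\Vert_1\le R\}$, let $f:\mathbb{R}^n\to\mathbb{R}$ be convex on $\mathcal{K}$ and differentiable at every point of $\mathcal{K}$, and let $\mathcal{X}^*=\arg\min_{\mathcal K}f$. Suppose that * $\Vert\nabla f(x)-\nabla f(y)\Vert_\infty\le\beta_1\Vert x-y\Vert_1$ for all $x,y\in\mathcal{K}$; * $\min_{x^*\in\mathcal{X}^*}\Vert x-x^*\Vert_2^2\le\frac{2}{\alpha_2}\left(f(x)-\min_{\mathcal K}f\right)$ for all $x\in\mathcal{K}$ (quadratic growth); * every $x^*\in\mathcal{X}^*$ has at most $s$ nonzero entries and satisfies $\Vert x^*\Vert_1=R$. Write $$N:=\max\Big\{1,\frac{\beta_1 s\max\{1,R^2\}}{\alpha_2}\Big\}\cdot\max\Big\{1,\log\frac{\beta_1R^2}{\epsilon}\Big\}.$$ (1) Consider any run $x_0,x_1,\dots$ of the away-steps Frank-Wolfe algorithm with exact line search over the atoms $\pm Re_1,\dots,\pm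 Re_n$, started at an atom. In every iteration, with $x=\sum_a w_a a$ the current convex combination of atoms and $g=\nabla f(x)$, it takes an atom $p$ minimizing $\langle g,\cdot\rangle$ over all atoms and an atom $v$ maximizing it over the atoms of positive weight; it moves in the direction $p-x$ with maximal step size $1$ if $\langle -g,p-x\rangle\ge\langle -g,x-v\rangle$, and otherwise in the direction $x-v$ with maximal step size $w_v/(1-w_v)$; the step size is found by exact line search and the weights are updated accordingly; ties are broken arbitrarily. Then $f(x_t)-\min_{\mathcal K}f\le\epsilon$ for all $t\ge C N$. Moreover, the stopping test $\max_{a}\langle-\nabla f(x_t),a-x_t\rangle\le\epsilon$ of the algorithm succeeds for some $t\le C N$, and the iterate returned at the first such $t$ is feasible and has $f(x_t)-\min_{\mathcal K}f\le\epsilon$. (2) There is a single real-RAM program (exact real arithmetic; every arithmetic operation, comparison, memory access, assignment and branch costs one step) which, for all $n,s,R,\beta_1,\alpha_2,\epsilon$ as above and every quadratic $f(x)=\frac12x^\top Ax+b^\top x$, $A\succeq0$, that satisfies the above assumptions, given only $n,A,b,R,\epsilon$ in memory, halts after at most $C\,n\,N$ steps and outputs the iterate that is returned, with tolerance $\epsilon$,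 by some run of the algorithm of (1) on $f$; this iterate is feasible and $\epsilon$-optimal in function value. -/

import Mathlib

noncomputable section

/-! The problem of minimizing a function over the `ℓ₁`-ball of radius `R` in `ℝⁿ`. -/

namespace L1Problem

/-- The `ℓ₁` norm on `ℝⁿ`. (The norm of `EuclideanSpace` itself is the `ℓ₂` norm.) -/
def l1norm {n : ℕ} (x : EuclideanSpace ℝ (Fin n)) : ℝ := ∑ i, |x i|

/-- The feasible set `{x ∈ ℝⁿ : ‖x‖₁ ≤ R}`. -/
def l1Ball (n : ℕ) (R : ℝ) : Set (EuclideanSpace ℝ (Fin n)) := {x | l1norm x ≤ R}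

/-- The number of nonzero entries. -/
def nnz {n : ℕ} (x : EuclideanSpace ℝ (Fin n)) : ℕ := Set.ncard {i | x i ≠ 0}

/-- `x` is an optimal solution of `min {f y : ‖y‖₁ ≤ R}`. -/
def IsOptimal {n : ℕ} (f : EuclideanSpace ℝ (Fin n) → ℝ) (R : ℝ)
    (x : EuclideanSpace ℝ (Fin n)) : Prop :=
  x ∈ l1Ball n R ∧ ∀ y ∈ l1Ball n R, f x ≤ f y

/-- `x` is feasible and `ε`-optimal in function value. -/
def IsApproxOptimal {n : ℕ} (f : EuclideanSpace ℝ (Fin n) → ℝ) (R ε : ℝ)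
    (x : EuclideanSpace ℝ (Fin n)) : Prop :=
  x ∈ l1Ball n R ∧ ∀ y ∈ l1Ball n R, f x - f y ≤ ε

/-- On the `ℓ₁`-ball the gradient of `f` is Lipschitz with constant `β₁` with respect to the
`ℓ₁` norm: `‖∇f(x) - ∇f(y)‖_∞ ≤ β₁ ‖x - y‖₁`. -/
def GradLipschitzL1 {n : ℕ} (f : EuclideanSpace ℝ (Fin n) → ℝ) (R β₁ : ℝ) : Prop :=
  ∀ x ∈ l1Ball n R, ∀ y ∈ l1Ball n R, ∀ i,
    |gradient f x i - gradient f y i| ≤ β₁ * l1norm (x - y)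

/-- Quadratic growth on the `ℓ₁`-ball with constant `α₂` with respect to the Euclidean norm:
the minimum over optimal solutions `z` of `‖x - z‖₂²` is at most `(2/α₂) (f x - f z)`. -/
def QuadraticGrowthL2 {n : ℕ} (f : EuclideanSpace ℝ (Fin n) → ℝ) (R α₂ : ℝ) : Prop :=
  ∀ x ∈ l1Ball n R, ∃ z, IsOptimal f R z ∧ ‖x - z‖ ^ 2 ≤ 2 / α₂ * (f x - f z)

/-- Every optimal solution has at most `s` nonzero entries and lies on the boundary. -/
def SparseBoundaryOptima {n : ℕ} (f : EuclideanSpace ℝ (Fin n) → ℝ) (R : ℝ) (s : ℕ) : Prop :=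
  ∀ z, IsOptimal f R z → nnz z ≤ s ∧ l1norm z = R

/-- The quadratic `x ↦ (1/2) xᵀ A x + bᵀ x`. -/
def quadObj {n : ℕ} (A : Matrix (Fin n) (Fin n) ℝ) (b : Fin n → ℝ)
    (x : EuclideanSpace ℝ (Fin n)) : ℝ :=
  (1 / 2 : ℝ) * (x.ofLp ⬝ᵥ A.mulVec x.ofLp) + b ⬝ᵥ x.ofLp

end L1Problem

/-! The away-steps Frank-Wolfe algorithm with exact line search over the `ℓ₁`-ball, whose atoms
are the vertices `±R eᵢ`. The state of the algorithm is the vector of the weights of the atoms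
in the current iterate; the active set consists of the atoms of positive weight. -/

namespace AFW

open L1Problem

/-- Names of the atoms: `(i, true)` stands for `R eᵢ`, and `(i, false)` for `-R eᵢ`. -/
abbrev Atom (n : ℕ) := Fin n × Bool

/-- The vertex of the `ℓ₁`-ball of radius `R` with a given name. -/
def vertex {n : ℕ} (R : ℝ) (a : Atom n) : EuclideanSpace ℝ (Fin n) :=
  EuclideanSpace.single a.1 (if a.2 then R else -R)

/-- The iterate that belongs to a vector of weights. -/
def point {n : ℕ} (R : ℝ) (w : Atom n → ℝ) : EuclideanSpace ℝ (Fin n) :=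
  ∑ a, w a • vertex R a

/-- The linear function `inner ℝ g ·` attains its minimum over the atoms (equivalently over the
ball) at `a`: the answer of the linear minimization oracle. -/
def IsFWAtom {n : ℕ} (R : ℝ) (g : EuclideanSpace ℝ (Fin n)) (a : Atom n) : Prop :=
  ∀ c, inner ℝ g (vertex R a) ≤ inner ℝ g (vertex R c)

/-- The linear function `inner ℝ g ·` attains its maximum over the active atoms at `a`. -/
def IsAwayAtom {n : ℕ} (R : ℝ) (w : Atom n → ℝ) (g : EuclideanSpace ℝ (Fin n))
    (a : Atom n) : Prop :=
  0 < w a ∧ ∀ c, 0 < w c → inner ℝ g (vertex R c) ≤ inner ℝ g (vertex R a)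

/-- `γ` minimizes `f (x + γ d)` over `[0, γmax]`. -/
def IsLineSearch {n : ℕ} (f : EuclideanSpace ℝ (Fin n) → ℝ) (x d : EuclideanSpace ℝ (Fin n))
    (γmax γ : ℝ) : Prop :=
  γ ∈ Set.Icc 0 γmax ∧ ∀ η ∈ Set.Icc 0 γmax, f (x + γ • d) ≤ f (x + η • d)

/-- One iteration, from the weights `w` to the weights `w'`. Ties are broken arbitrarily. -/
inductive Step {n : ℕ} (f : EuclideanSpace ℝ (Fin n) → ℝ) (R : ℝ) (w : Atom n → ℝ) :
    (Atom n → ℝ) → Prop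
  /-- A Frank-Wolfe step, in the direction `vertex p - x`. -/
  | frankWolfe (p v : Atom n) (γ : ℝ)
      (hp : IsFWAtom R (gradient f (point R w)) p)
      (hv : IsAwayAtom R w (gradient f (point R w)) v)
      (hdir : inner ℝ (-gradient f (point R w)) (point R w - vertex R v) ≤
        inner ℝ (-gradient f (point R w)) (vertex R p - point R w))
      (hγ : IsLineSearch f (point R w) (vertex R p - point R w) 1 γ) :
      Step f R w (fun a => (1 - γ) * w a + if a = p then γ else 0)
  /-- An away step, in the direction `x - vertex v`. -/
  | away (p v : Atom n) (γ : ℝ)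
      (hp : IsFWAtom R (gradient f (point R w)) p)
      (hv : IsAwayAtom R w (gradient f (point R w)) v)
      (hdir : inner ℝ (-gradient f (point R w)) (vertex R p - point R w) <
        inner ℝ (-gradient f (point R w)) (point R w - vertex R v))
      (hγ : IsLineSearch f (point R w) (point R w - vertex R v) (w v / (1 - w v)) γ) :
      Step f R w (fun a => (1 + γ) * w a - if a = v then γ else 0)

/-- A run of the algorithm (without its stopping test), started from some vertex. -/
def IsRun {n : ℕ} (f : EuclideanSpace ℝ (Fin n) → ℝ) (R : ℝ) (w : ℕ → Atom n → ℝ) : Prop :=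
  (∃ a₀, w 0 = Pi.single a₀ 1) ∧ ∀ t, Step f R (w t) (w (t + 1))

/-- The stopping test at the point `x` with tolerance `ε`: the Frank-Wolfe gap, that is, the
maximum over the atoms `a` of `⟨-∇f(x), a - x⟩`, is at most `ε`. -/
def GapAtMost {n : ℕ} (f : EuclideanSpace ℝ (Fin n) → ℝ) (R ε : ℝ)
    (x : EuclideanSpace ℝ (Fin n)) : Prop :=
  ∀ a, inner ℝ (-gradient f x) (vertex R a - x) ≤ ε

/-- With tolerance `ε`, the run `w` passes the stopping test for the first time in iteration
`t`; the algorithm then returns `point R (w t)`. -/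
def ReturnsAt {n : ℕ} (f : EuclideanSpace ℝ (Fin n) → ℝ) (R ε : ℝ) (w : ℕ → Atom n → ℝ)
    (t : ℕ) : Prop :=
  GapAtMost f R ε (point R (w t)) ∧ ∀ k < t, ¬ GapAtMost f R ε (point R (w k))

end AFW

/-! A real random access machine: programs in a small imperative language over natural-number
variables (used as indices) and random-access arrays of real numbers, with exact arithmetic, in
which every arithmetic operation, comparison, memory access, assignment and branch costs one
step. There is no multiplication of indices and no rounding from reals to indices. -/

namespace RealRAM

/-- A memory: the values of the natural-number variables and the contents of the arrays. -/
structure Mem where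
  nat : ℕ → ℕ
  arr : ℕ → ℕ → ℝ

/-- Index expressions. -/
inductive NExp where
  | const (k : ℕ)
  | var (i : ℕ)
  | add (e₁ e₂ : NExp)
  | sub (e₁ e₂ : NExp)

/-- The value of an index expression (subtraction is truncated at `0`). -/
def NExp.eval (σ : Mem) : NExp → ℕ
  | .const k => k
  | .var i => σ.nat i
  | .add e₁ e₂ => e₁.eval σ + e₂.eval σ
  | .sub e₁ e₂ => e₁.eval σ - e₂.eval σ

/-- The number of steps to evaluate an index expression. -/
def NExp.cost : NExp → ℕ
  | .const _ => 1
  | .var _ => 1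
  | .add e₁ e₂ => e₁.cost + e₂.cost + 1
  | .sub e₁ e₂ => e₁.cost + e₂.cost + 1

/-- Real expressions; `cell a e` is the entry of array `a` at index `e`. -/
inductive RExp where
  | const (q : ℚ)
  | cell (a : ℕ) (e : NExp)
  | add (e₁ e₂ : RExp)
  | sub (e₁ e₂ : RExp)
  | mul (e₁ e₂ : RExp)
  | div (e₁ e₂ : RExp)

/-- The value of a real expression (a division by `0` returns `0`). -/
def RExp.eval (σ : Mem) : RExp → ℝ
  | .const q => (q : ℝ)
  | .cell a e => σ.arr a (e.eval σ)
  | .add e₁ e₂ => e₁.eval σ + e₂.eval σ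
  | .sub e₁ e₂ => e₁.eval σ - e₂.eval σ
  | .mul e₁ e₂ => e₁.eval σ * e₂.eval σ
  | .div e₁ e₂ => e₁.eval σ / e₂.eval σ

/-- The number of steps to evaluate a real expression. -/
def RExp.cost : RExp → ℕ
  | .const _ => 1
  | .cell _ e => e.cost + 1
  | .add e₁ e₂ => e₁.cost + e₂.cost + 1
  | .sub e₁ e₂ => e₁.cost + e₂.cost + 1
  | .mul e₁ e₂ => e₁.cost + e₂.cost + 1
  | .div e₁ e₂ => e₁.cost + e₂.cost + 1

/-- Tests. -/
inductive BExp where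
  | ltN (e₁ e₂ : NExp)
  | ltR (e₁ e₂ : RExp)
  | neg (c : BExp)
  | conj (c₁ c₂ : BExp)

/-- The truth value of a test. -/
def BExp.holds (σ : Mem) : BExp → Prop
  | .ltN e₁ e₂ => e₁.eval σ < e₂.eval σ
  | .ltR e₁ e₂ => e₁.eval σ < e₂.eval σ
  | .neg c => ¬ c.holds σ
  | .conj c₁ c₂ => c₁.holds σ ∧ c₂.holds σ

/-- The number of steps to evaluate a test. -/
def BExp.cost : BExp → ℕ
  | .ltN e₁ e₂ => e₁.cost + e₂.cost + 1
  | .ltR e₁ e₂ => e₁.cost + e₂.cost + 1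
  | .neg c => c.cost + 1
  | .conj c₁ c₂ => c₁.cost + c₂.cost + 1

/-- Programs. -/
inductive Prog where
  | skip
  | setN (i : ℕ) (e : NExp)
  | setR (a : ℕ) (idx : NExp) (e : RExp)
  | seq (p q : Prog)
  | branch (c : BExp) (p q : Prog)
  | loop (c : BExp) (p : Prog)

/-- Assignment to a natural-number variable. -/
def Mem.setN (σ : Mem) (i k : ℕ) : Mem :=
  { σ with nat := Function.update σ.nat i k }

/-- Assignment to one entry of an array. -/
def Mem.setR (σ : Mem) (a k : ℕ) (r : ℝ) : Mem :=
  { σ with arr := Function.update σ.arr a (Function.update (σ.arr a) k r) }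

/-- `Exec p σ τ T`: started in the memory `σ`, the program `p` halts in the memory `τ` after
exactly `T` steps. -/
inductive Exec : Prog → Mem → Mem → ℕ → Prop
  | skip (σ : Mem) : Exec .skip σ σ 1
  | setN (σ : Mem) (i : ℕ) (e : NExp) :
      Exec (.setN i e) σ (σ.setN i (e.eval σ)) (e.cost + 1)
  | setR (σ : Mem) (a : ℕ) (idx : NExp) (e : RExp) :
      Exec (.setR a idx e) σ (σ.setR a (idx.eval σ) (e.eval σ)) (idx.cost + e.cost + 1)
  | seq {p q : Prog} {σ τ υ : Mem} {T U : ℕ} (hp : Exec p σ τ T) (hq : Exec q τ υ U) :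
      Exec (.seq p q) σ υ (T + U)
  | branch_true {c : BExp} {p q : Prog} {σ τ : Mem} {T : ℕ} (hc : c.holds σ)
      (hp : Exec p σ τ T) : Exec (.branch c p q) σ τ (c.cost + 1 + T)
  | branch_false {c : BExp} {p q : Prog} {σ τ : Mem} {T : ℕ} (hc : ¬ c.holds σ)
      (hq : Exec q σ τ T) : Exec (.branch c p q) σ τ (c.cost + 1 + T)
  | loop_true {c : BExp} {p : Prog} {σ τ υ : Mem} {T U : ℕ} (hc : c.holds σ)
      (hp : Exec p σ τ T) (hl : Exec (.loop c p) τ υ U) :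
      Exec (.loop c p) σ υ (c.cost + 1 + T + U)
  | loop_false {c : BExp} {p : Prog} {σ : Mem} (hc : ¬ c.holds σ) :
      Exec (.loop c p) σ σ (c.cost + 1)

/-- The memory at the start: variable `0` holds `n`, array `0` holds the matrix `A` row by row,
array `1` holds `b`, array `2` holds `R` and `ε`, and everything else is `0`. -/
def inputMem {n : ℕ} (A : Matrix (Fin n) (Fin n) ℝ) (b : Fin n → ℝ) (R ε : ℝ) : Mem where
  nat := fun i => if i = 0 then n else 0
  arr := fun a k =>
    match a with
    | 0 => if h : k < n * n then
        A (finProdFinEquiv.symm ⟨k, h⟩).1 (finProdFinEquiv.symm ⟨k, h⟩).2 else 0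
    | 1 => if h : k < n then b ⟨k, h⟩ else 0
    | 2 => if k = 0 then R else if k = 1 then ε else 0
    | _ => 0

/-- The output: the first `n` entries of array `3`. -/
def output (n : ℕ) (σ : Mem) : EuclideanSpace ℝ (Fin n) :=
  WithLp.toLp 2 (fun i => σ.arr 3 i)

end RealRAM

end

/-!
The iteration bound rests on a lower bound for the directional gap. Let `x` be a convex combination
of atoms with weights `w`, let `z` be the nearest minimizer, and let `p` and `v` be the Frank-Wolfe
and the away atom. As `z` lies on the boundary of the ball, it has unique weights as a convex
combination of atoms, supported on at most `s` of them. The weight that has to be moved to turn `w`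
into these weights is at most `R⁻¹` times the `ℓ₁` distance of `x` and `z` on the support of `z`,
hence at most `R⁻¹ √s ‖x - z‖₂`, which quadratic growth bounds by the primal gap
(`AFW.mul_sum_max_le`). Moving one unit of weight changes the linearization of `f` by at most
`⟨-∇f(x), p - v⟩` (`AFW.inner_sub_le_mul`), and so convexity gives
`α₂ R² (f(x) - f(z)) ≤ 8 s G²` for the larger directional gap `G`
(`AFW.primal_gap_le_directional_gap_sq`). Since atoms have `ℓ₁` distance at most `2 R`, a step that
is not cut off decreases `f` by about `G² / (8 β₁ R²)`, which is a fraction of the order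
`α₂ / (β₁ s)` of the primal gap. A step that is cut off is an away step that removes an active
atom. Every other step adds at most one atom, so at least about half of all steps are good
(`AFW.Step.progress`, `AFW.IsRun.exists_bound`). The first step, from a vertex, brings the primal
gap below `2 β₁ R²`. The Frank-Wolfe gap is at most `G`; once the primal gap is less than the
decrease that a gap above `ε` would force, the stopping test must succeed
(`AFW.IsRun.iteration_bound`).

For quadratics, the program keeps the weights and the vector `A x`. A step towards or away from an
atom with signed step size `κ` replaces `x` by `(1 - κ) x + κ a`, so that `A x` is updated with one
row of `A`, and the line search has a closed form in which the curvature is computed from `A x` and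
one diagonal entry. One iteration thus takes `O(n)` machine steps
(`RealRAM.AFWProg.Rep.runs_iteration`). Iterating the body of the main loop regardless of the
stopping test gives an infinite run of the algorithm, which the program follows up to the first
success of the test (`RealRAM.AFWProg.exists_run`); the iteration bound applies to this run.
-/

noncomputable section

/-! ### The `ℓ₁`-ball -/

namespace L1Problem

variable {n : ℕ}

theorem inner_eq_sum (x y : EuclideanSpace ℝ (Fin n)) : inner ℝ x y = ∑ i, x i * y i := by
  rw [PiLp.inner_apply]
  exact Finset.sum_congr rfl fun i _ => by simp [mul_comm]

theorem l1norm_nonneg (x : EuclideanSpace ℝ (Fin n)) : 0 ≤ l1norm x :=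
  Finset.sum_nonneg fun _ _ => abs_nonneg _

theorem l1norm_add_le (x y : EuclideanSpace ℝ (Fin n)) :
    l1norm (x + y) ≤ l1norm x + l1norm y := by
  unfold l1norm
  rw [← Finset.sum_add_distrib]
  exact Finset.sum_le_sum fun i _ => by simpa using abs_add_le (x i) (y i)

theorem l1norm_smul (c : ℝ) (x : EuclideanSpace ℝ (Fin n)) :
    l1norm (c • x) = |c| * l1norm x := by
  simp [l1norm, abs_mul, Finset.mul_sum]

theorem l1norm_sub_le (x y : EuclideanSpace ℝ (Fin n)) :
    l1norm (x - y) ≤ l1norm x + l1norm y := by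
  have h := l1norm_add_le x ((-1 : ℝ) • y)
  rw [l1norm_smul] at h
  simpa [sub_eq_add_neg] using h

theorem convex_l1Ball (R : ℝ) : Convex ℝ (l1Ball n R) := by
  intro x hx y hy a b ha hb hab
  have h := l1norm_add_le (a • x) (b • y)
  rw [l1norm_smul, l1norm_smul, abs_of_nonneg ha, abs_of_nonneg hb] at h
  have hx' : l1norm x ≤ R := hx
  have hy' : l1norm y ≤ R := hy
  change l1norm (a • x + b • y) ≤ R
  have : R = a * R + b * R := by rw [← add_mul, hab, one_mul]
  nlinarith [mul_le_mul_of_nonneg_left hx' ha, mul_le_mul_of_nonneg_left hy' hb]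

theorem add_smul_mem_l1Ball {R η t : ℝ} {x d : EuclideanSpace ℝ (Fin n)} (hx : x ∈ l1Ball n R)
    (hη : x + η • d ∈ l1Ball n R) (ht : t ∈ Set.Icc 0 η) : x + t • d ∈ l1Ball n R := by
  rcases ht.1.eq_or_lt with h0 | h0
  · simpa [← h0] using hx
  · have hη0 : 0 < η := h0.trans_le ht.2
    have h := (convex_l1Ball R).add_smul_mem hx hη (t := t / η)
      ⟨by positivity, (div_le_one hη0).2 ht.2⟩
    rwa [smul_smul, div_mul_cancel₀ _ hη0.ne'] at h

/-- Hölder's inequality for the dual norms `ℓ_∞` and `ℓ₁`. -/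
theorem inner_le_mul_l1norm {c : ℝ} {g d : EuclideanSpace ℝ (Fin n)} (h : ∀ i, |g i| ≤ c) :
    inner ℝ g d ≤ c * l1norm d := by
  rw [inner_eq_sum, l1norm, Finset.mul_sum]
  refine Finset.sum_le_sum fun i _ => (le_abs_self _).trans ?_
  rw [abs_mul]
  exact mul_le_mul_of_nonneg_right (h i) (abs_nonneg _)

/-! ### Smooth convex functions along segments of the ball -/

variable {f : EuclideanSpace ℝ (Fin n) → ℝ} {R β : ℝ} {x y d : EuclideanSpace ℝ (Fin n)}

theorem hasDerivAt_line {t : ℝ} (h : DifferentiableAt ℝ f (x + t • d)) :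
    HasDerivAt (fun t : ℝ => f (x + t • d)) (inner ℝ (gradient f (x + t • d)) d) t := by
  have h1 : HasDerivAt (fun t : ℝ => x + t • d) d t := by
    simpa using ((hasDerivAt_id t).smul_const d).const_add x
  have h2 := h.hasGradientAt.hasFDerivAt.comp_hasDerivAt t h1
  rwa [InnerProductSpace.toDual_apply_apply] at h2

theorem inner_gradient_sub_le (hlip : GradLipschitzL1 f R β) (hx : x ∈ l1Ball n R) {t : ℝ}
    (ht : 0 ≤ t) (hy : x + t • d ∈ l1Ball n R) :
    inner ℝ (gradient f (x + t • d)) d - inner ℝ (gradient f x) d ≤ β * t * l1norm d ^ 2 := by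
  have h := inner_le_mul_l1norm (g := gradient f (x + t • d) - gradient f x) (d := d)
    (c := β * l1norm (x + t • d - x)) (fun i => by simpa using hlip _ hy _ hx i)
  rw [inner_sub_left, add_sub_cancel_left, l1norm_smul, abs_of_nonneg ht] at h
  calc _ ≤ _ := h
    _ = _ := by ring

/-- The quadratic upper bound for functions whose gradient is Lipschitz in the `ℓ₁` norm. -/
theorem descent_le (hdiff : ∀ x ∈ l1Ball n R, DifferentiableAt ℝ f x)
    (hlip : GradLipschitzL1 f R β) (hx : x ∈ l1Ball n R) {η : ℝ} (hη : 0 ≤ η)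
    (hy : x + η • d ∈ l1Ball n R) :
    f (x + η • d) ≤ f x + η * inner ℝ (gradient f x) d + β / 2 * η ^ 2 * l1norm d ^ 2 := by
  have hmem : ∀ t ∈ Set.Icc 0 η, x + t • d ∈ l1Ball n R := fun t ht =>
    add_smul_mem_l1Ball hx hy ht
  have hder : ∀ t ∈ Set.Icc 0 η, HasDerivAt
      (fun t : ℝ => f (x + t • d) - (t * inner ℝ (gradient f x) d + β / 2 * t ^ 2 * l1norm d ^ 2))
      (inner ℝ (gradient f (x + t • d)) d -
        (inner ℝ (gradient f x) d + β * t * l1norm d ^ 2)) t := by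
    intro t ht
    refine (hasDerivAt_line (hdiff _ (hmem t ht))).sub ?_
    have h1 := ((hasDerivAt_id t).mul_const (inner ℝ (gradient f x) d)).add
      ((((hasDerivAt_id t).pow 2).const_mul (β / 2)).mul_const (l1norm d ^ 2))
    refine h1.congr_deriv ?_
    simp only [id, Nat.cast_ofNat, Nat.add_one_sub_one, pow_one]
    ring
  have hanti := antitoneOn_of_deriv_nonpos (convex_Icc 0 η)
    (fun t ht => (hder t ht).continuousAt.continuousWithinAt)
    (fun t ht => (hder t (interior_subset ht)).differentiableAt.differentiableWithinAt)
    (fun t ht => by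
      have ht' := interior_subset ht
      rw [(hder t ht').deriv]
      have := inner_gradient_sub_le hlip hx ht'.1 (hmem t ht')
      linarith)
  have h := hanti (Set.left_mem_Icc.2 hη) (Set.right_mem_Icc.2 hη) hη
  simp only [zero_smul, add_zero, zero_mul] at h
  linarith

/-- The first-order characterization of convexity. -/
theorem inner_gradient_le_sub (hconv : ConvexOn ℝ (l1Ball n R) f)
    (hdiff : ∀ x ∈ l1Ball n R, DifferentiableAt ℝ f x) (hx : x ∈ l1Ball n R)
    (hy : y ∈ l1Ball n R) : inner ℝ (gradient f x) (y - x) ≤ f y - f x := by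
  have hφ : ConvexOn ℝ (Set.Icc 0 1) (fun t : ℝ => f (x + t • (y - x))) := by
    have h := hconv.comp_affineMap (AffineMap.lineMap x y)
    have h2 := h.subset (s := Set.Icc (0 : ℝ) 1) (fun t ht => ?_) (convex_Icc 0 1)
    · refine h2.congr fun t _ => ?_
      simp [AffineMap.lineMap_apply, add_comm]
    · exact (convex_l1Ball R).lineMap_mem hx hy ht
  have h := hφ.le_slope_of_hasDerivAt (Set.left_mem_Icc.2 zero_le_one)
    (Set.right_mem_Icc.2 zero_le_one) zero_lt_one
    (hasDerivAt_line (d := y - x) (t := 0) (by simpa using hdiff x hx))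
  simpa [slope_def_field] using h

end L1Problem

namespace AFW

open L1Problem

variable {n : ℕ} {f : EuclideanSpace ℝ (Fin n) → ℝ} {R β : ℝ} {x d : EuclideanSpace ℝ (Fin n)}

/-! ### Exact line search -/

theorem IsLineSearch.le {γmax γ : ℝ} (h : IsLineSearch f x d γmax γ) : f (x + γ • d) ≤ f x := by
  simpa using h.2 0 ⟨le_rfl, h.1.1.trans h.1.2⟩

/-- Every admissible step size `η` bounds the outcome of the line search from above, by the
quadratic upper bound on `f`; the atoms have `ℓ₁`-diameter `2 R`. -/
theorem IsLineSearch.le_quadratic (hdiff : ∀ x ∈ l1Ball n R, DifferentiableAt ℝ f x)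
    (hlip : GradLipschitzL1 f R β) (hβ : 0 ≤ β) (hx : x ∈ l1Ball n R) {γmax γ η : ℝ}
    (hd : l1norm d ≤ 2 * R) (hmax : x + γmax • d ∈ l1Ball n R)
    (h : IsLineSearch f x d γmax γ) (hη : η ∈ Set.Icc 0 γmax) :
    f (x + γ • d) ≤ f x - η * inner ℝ (-gradient f x) d + 2 * β * R ^ 2 * η ^ 2 := by
  refine (h.2 η hη).trans ?_
  refine (descent_le hdiff hlip hx hη.1 (add_smul_mem_l1Ball hx hmax hη)).trans ?_
  have h2 : l1norm d ^ 2 ≤ (2 * R) ^ 2 := pow_le_pow_left₀ (l1norm_nonneg d) hd 2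
  have h3 := mul_le_mul_of_nonneg_left h2 (show 0 ≤ β / 2 * η ^ 2 by positivity)
  rw [inner_neg_left]
  linarith

/-- A line search that stops before the end of its interval has gone at least as far as the
minimizer of the quadratic upper bound, because the derivative is nonnegative there. -/
theorem IsLineSearch.le_step (hdiff : ∀ x ∈ l1Ball n R, DifferentiableAt ℝ f x)
    (hlip : GradLipschitzL1 f R β) (hβ : 0 < β) (hR : 0 < R) (hx : x ∈ l1Ball n R) {γmax γ : ℝ}
    (hd : l1norm d ≤ 2 * R) (hmax : x + γmax • d ∈ l1Ball n R)
    (h : IsLineSearch f x d γmax γ) (hlt : γ < γmax) :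
    inner ℝ (-gradient f x) d / (4 * β * R ^ 2) ≤ γ := by
  have hmem := add_smul_mem_l1Ball hx hmax h.1
  have hder := hasDerivAt_line (hdiff _ hmem)
  have h0 : 0 ≤ inner ℝ (gradient f (x + γ • d)) d := by
    refine ge_of_tendsto hder.tendsto_slope_zero_right ?_
    filter_upwards [Ioo_mem_nhdsGT (show (0 : ℝ) < γmax - γ by linarith)] with t ht
    have := h.2 (γ + t) ⟨add_nonneg h.1.1 ht.1.le, by linarith [ht.2]⟩
    exact smul_nonneg (inv_nonneg.2 ht.1.le) (sub_nonneg.2 this)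
  have h1 := inner_gradient_sub_le hlip hx h.1.1 hmem
  have h2 : l1norm d ^ 2 ≤ (2 * R) ^ 2 := pow_le_pow_left₀ (l1norm_nonneg d) hd 2
  have h3 := mul_le_mul_of_nonneg_left h2 (mul_nonneg hβ.le h.1.1)
  rw [div_le_iff₀ (by positivity), inner_neg_left]
  nlinarith

end AFW

namespace AFW

open L1Problem

/-! ### Convex combinations of atoms -/

/-- The nonnegative weight vectors of total weight one. -/
def IsWeights {n : ℕ} (w : Atom n → ℝ) : Prop := (∀ a, 0 ≤ w a) ∧ ∑ a, w a = 1

variable {n : ℕ} {f : EuclideanSpace ℝ (Fin n) → ℝ} {R : ℝ} {w : Atom n → ℝ}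
  {g x y z : EuclideanSpace ℝ (Fin n)}

theorem inner_vertex (g : EuclideanSpace ℝ (Fin n)) (a : Atom n) :
    inner ℝ g (vertex R a) = (if a.2 then R else -R) * g a.1 := by
  simp [vertex, EuclideanSpace.inner_single_right]

theorem inner_point (g : EuclideanSpace ℝ (Fin n)) (w : Atom n → ℝ) :
    inner ℝ g (point R w) = ∑ a, w a * inner ℝ g (vertex R a) := by
  simp [point, inner_sum, inner_smul_right]

theorem point_apply (w : Atom n → ℝ) (i : Fin n) :
    point R w i = R * (w (i, true) - w (i, false)) := by
  have h : point R w i = ∑ a : Atom n, w a * vertex R a i := by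
    simp [point]
  rw [h, Fintype.sum_prod_type, Finset.sum_eq_single i]
  · simp [vertex]
    ring
  · intro j _ hj
    simp [vertex, hj.symm]
  · simp

theorem l1norm_vertex (hR : 0 ≤ R) (a : Atom n) : l1norm (vertex R a) = R := by
  unfold l1norm vertex
  rw [Finset.sum_eq_single a.1]
  · cases a.2 <;> simp [abs_of_nonneg hR]
  · intro j _ hj
    simp [hj]
  · simp

theorem vertex_mem (hR : 0 ≤ R) (a : Atom n) : vertex R a ∈ l1Ball n R := (l1norm_vertex hR a).le

theorem point_single (a : Atom n) : point R (Pi.single a 1) = vertex R a := by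
  simp [point, Pi.single_apply]

theorem point_mem (hR : 0 ≤ R) (hw : IsWeights w) : point R w ∈ l1Ball n R :=
  (convex_l1Ball R).sum_mem (fun a _ => hw.1 a) hw.2 fun a _ => vertex_mem hR a

theorem l1norm_sub_le_two_mul (hx : x ∈ l1Ball n R) (hy : y ∈ l1Ball n R) :
    l1norm (x - y) ≤ 2 * R := by
  have h := l1norm_sub_le x y
  have hx' : l1norm x ≤ R := hx
  have hy' : l1norm y ≤ R := hy
  linarith

theorem inner_vertex_le_of_mem (hR : 0 < R) {p : Atom n} (hp : IsFWAtom R g p)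
    (hy : y ∈ l1Ball n R) : inner ℝ g (vertex R p) ≤ inner ℝ g y := by
  have hc : ∀ i, |(-g) i| ≤ -inner ℝ g (vertex R p) / R := by
    intro i
    have h1 := hp (i, true)
    have h2 := hp (i, false)
    rw [inner_vertex g (i, true)] at h1
    rw [inner_vertex g (i, false)] at h2
    simp only [if_true, Bool.false_eq_true, if_false] at h1 h2
    rw [le_div_iff₀ hR, PiLp.neg_apply, abs_neg, mul_comm, ← abs_of_pos hR, ← abs_mul, abs_le,
      abs_of_pos hR]
    constructor <;> linarith
  have h := inner_le_mul_l1norm (d := y) hc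
  have h0 : 0 ≤ -inner ℝ g (vertex R p) / R := (abs_nonneg _).trans (hc p.1)
  have h1 := mul_le_mul_of_nonneg_left (show l1norm y ≤ R from hy) h0
  rw [div_mul_cancel₀ _ hR.ne'] at h1
  rw [inner_neg_left] at h
  linarith

/-- The Frank-Wolfe gap bounds the primal gap. -/
theorem sub_le_inner (hR : 0 < R) (hconv : ConvexOn ℝ (l1Ball n R) f)
    (hdiff : ∀ x ∈ l1Ball n R, DifferentiableAt ℝ f x) {p : Atom n}
    (hp : IsFWAtom R (gradient f x) p) (hx : x ∈ l1Ball n R) (hy : y ∈ l1Ball n R) :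
    f x - f y ≤ inner ℝ (-gradient f x) (vertex R p - x) := by
  have h1 := inner_gradient_le_sub hconv hdiff hx hy
  have h2 := inner_vertex_le_of_mem hR hp hy
  rw [inner_sub_right] at h1
  rw [inner_neg_left, inner_sub_right]
  linarith

theorem exists_isFWAtom [Nonempty (Atom n)] (R : ℝ) (g : EuclideanSpace ℝ (Fin n)) :
    ∃ p, IsFWAtom R g p := Finite.exists_min _

theorem GapAtMost.isApproxOptimal {ε : ℝ} [Nonempty (Atom n)] (h : GapAtMost f R ε x) (hR : 0 < R)
    (hconv : ConvexOn ℝ (l1Ball n R) f) (hdiff : ∀ x ∈ l1Ball n R, DifferentiableAt ℝ f x)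
    (hx : x ∈ l1Ball n R) : IsApproxOptimal f R ε x := by
  obtain ⟨p, hp⟩ := exists_isFWAtom R (gradient f x)
  exact ⟨hx, fun y hy => (sub_le_inner hR hconv hdiff hp hx hy).trans (h p)⟩

/-! ### The directional gap and quadratic growth -/

/-- The weights of a boundary point of the ball as a convex combination of atoms. -/
def boundaryWeights (R : ℝ) (z : EuclideanSpace ℝ (Fin n)) (a : Atom n) : ℝ :=
  max (if a.2 then z a.1 else -z a.1) 0 / R

theorem boundaryWeights_nonneg (hR : 0 < R) (a : Atom n) : 0 ≤ boundaryWeights R z a :=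
  div_nonneg (le_max_right _ _) hR.le

theorem sum_boundaryWeights (hR : 0 < R) (hz : l1norm z = R) :
    ∑ a, boundaryWeights R z a = 1 := by
  rw [Fintype.sum_prod_type]
  have : ∀ i, ∑ b : Bool, boundaryWeights R z (i, b) = |z i| / R := by
    intro i
    simp [boundaryWeights, ← add_div]
  simp_rw [this]
  rw [← Finset.sum_div, div_eq_one_iff_eq hR.ne']
  exact hz

theorem point_boundaryWeights (hR : 0 < R) : point R (boundaryWeights R z) = z := by
  ext i
  rw [point_apply]
  simp only [boundaryWeights, if_true, Bool.false_eq_true, if_false, ← sub_div]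
  rw [max_zero_sub_max_neg_zero_eq_self, mul_div_cancel₀ _ hR.ne']

/-- The weight that has to be moved to turn the convex combination `w` into a boundary point `z`
of the ball is at most the `ℓ₁` distance on the support of `z`. -/
theorem mul_sum_max_le (hR : 0 < R) (hw : IsWeights w) :
    R * ∑ a, max (boundaryWeights R z a - w a) 0 ≤
      ∑ i with z i ≠ 0, |point R w i - z i| := by
  rw [Fintype.sum_prod_type, Finset.mul_sum, Finset.sum_filter]
  refine Finset.sum_le_sum fun i _ => ?_
  have ht := hw.1 (i, true)
  have hf := hw.1 (i, false)
  have hRt := mul_nonneg hR.le ht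
  have hRf := mul_nonneg hR.le hf
  rw [point_apply, Fintype.sum_bool, mul_add, mul_max_of_nonneg _ _ hR.le,
    mul_max_of_nonneg _ _ hR.le]
  simp only [boundaryWeights, mul_sub, mul_div_cancel₀ _ hR.ne', mul_zero, if_true,
    Bool.false_eq_true, if_false]
  rcases lt_trichotomy (z i) 0 with h | h | h
  · rw [if_pos h.ne, max_eq_right h.le, max_eq_left (by linarith : 0 ≤ -z i),
      max_eq_right (by linarith), zero_add]
    refine max_le ?_ (abs_nonneg _)
    exact le_trans (by linarith) (le_abs_self _)
  · rw [if_neg (by simpa using h), h]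
    simp [hRt, hRf]
  · rw [if_pos h.ne', max_eq_left h.le, max_eq_right (by linarith : -z i ≤ 0),
      max_eq_right (by linarith : 0 - R * w (i, false) ≤ 0), add_zero]
    refine max_le ?_ (abs_nonneg _)
    exact le_trans (by linarith) (neg_le_abs _)

/-- A linear function decreases from `point R w` to a boundary point `z` by at most the weight
that has to be moved, times the difference of its values at the away and Frank-Wolfe atoms. -/
theorem inner_sub_le_mul (hR : 0 < R) (hw : IsWeights w) (hz : l1norm z = R) {p v : Atom n}
    (hp : IsFWAtom R g p) (hv : IsAwayAtom R w g v) :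
    inner ℝ g (point R w - z) ≤
      (∑ a, max (boundaryWeights R z a - w a) 0) * inner ℝ g (vertex R v - vertex R p) := by
  have hsum : ∑ a, (w a - boundaryWeights R z a) = 0 := by
    rw [Finset.sum_sub_distrib, hw.2, sum_boundaryWeights hR hz, sub_self]
  have hterm : ∀ a, (w a - boundaryWeights R z a) * inner ℝ g (vertex R a) ≤
      max (boundaryWeights R z a - w a) 0 * inner ℝ g (vertex R v - vertex R p) +
        (w a - boundaryWeights R z a) * inner ℝ g (vertex R v) := by
    intro a
    have h0 := boundaryWeights_nonneg (z := z) hR a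
    rw [inner_sub_right]
    rcases le_total (w a) (boundaryWeights R z a) with h | h
    · rw [max_eq_left (by linarith)]
      nlinarith [mul_le_mul_of_nonneg_left (hp a) (sub_nonneg.2 h)]
    · rw [max_eq_right (by linarith), zero_mul, zero_add]
      rcases h.eq_or_lt with h' | h'
      · simp [h']
      · exact mul_le_mul_of_nonneg_left (hv.2 a (h0.trans_lt h')) (sub_nonneg.2 h)
  calc inner ℝ g (point R w - z)
      = ∑ a, (w a - boundaryWeights R z a) * inner ℝ g (vertex R a) := by
        conv_lhs => rw [← point_boundaryWeights (z := z) hR]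
        rw [inner_sub_right, inner_point, inner_point, ← Finset.sum_sub_distrib]
        simp_rw [sub_mul]
    _ ≤ _ := Finset.sum_le_sum fun a _ => hterm a
    _ = _ := by rw [Finset.sum_add_distrib, ← Finset.sum_mul, ← Finset.sum_mul, hsum]; ring

theorem sum_abs_sq_le_nnz_mul (x z : EuclideanSpace ℝ (Fin n)) :
    (∑ i with z i ≠ 0, |x i - z i|) ^ 2 ≤ nnz z * ‖x - z‖ ^ 2 := by
  have hcard : nnz z = (Finset.univ.filter fun i => z i ≠ 0).card := by
    rw [nnz, ← Set.ncard_coe_finset]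
    simp
  rw [hcard, EuclideanSpace.norm_sq_eq]
  refine sq_sum_le_card_mul_sum_sq.trans ?_
  refine mul_le_mul_of_nonneg_left ?_ (Nat.cast_nonneg _)
  refine (Finset.sum_le_univ_sum_of_nonneg fun i => sq_nonneg _).trans_eq ?_
  simp

/-- The lower bound that makes the method converge linearly: if the optimal solutions are
`s`-sparse boundary points, the larger of the two directional gaps is at least of the order of
the square root of the primal gap, with a factor that depends on `s` instead of `n`. -/
theorem primal_gap_le_directional_gap_sq {α : ℝ} {s : ℕ} (hR : 0 < R) (hα : 0 < α)
    (hconv : ConvexOn ℝ (l1Ball n R) f) (hdiff : ∀ x ∈ l1Ball n R, DifferentiableAt ℝ f x)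
    (hqg : QuadraticGrowthL2 f R α) (hsparse : SparseBoundaryOptima f R s) (hw : IsWeights w)
    (hy : IsOptimal f R y) {p v : Atom n} (hp : IsFWAtom R (gradient f (point R w)) p)
    (hv : IsAwayAtom R w (gradient f (point R w)) v) {G : ℝ}
    (hGp : inner ℝ (-gradient f (point R w)) (vertex R p - point R w) ≤ G)
    (hGv : inner ℝ (-gradient f (point R w)) (point R w - vertex R v) ≤ G) :
    α * R ^ 2 * (f (point R w) - f y) ≤ 8 * s * G ^ 2 := by
  have hx := point_mem hR.le hw
  obtain ⟨z, hz, hdist⟩ := hqg _ hx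
  obtain ⟨hnnz, hzR⟩ := hsparse z hz
  have hyz : f y = f z := le_antisymm (hy.2 z hz.1) (hz.2 y hy.1)
  rw [hyz]
  set x := point R w with hxdef
  set g := gradient f x with hg
  set h := f x - f z with hh
  set Γ := inner ℝ g (vertex R v - vertex R p) with hΓ
  set m := ∑ i with z i ≠ 0, |x i - z i| with hm
  have hh0 : 0 ≤ h := sub_nonneg.2 (hz.2 x hx)
  have hΓ0 : 0 ≤ Γ := by rw [hΓ, inner_sub_right]; linarith [hp v]
  have hΓG : Γ ≤ 2 * G := by
    rw [hΓ, inner_sub_right]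
    rw [inner_neg_left, inner_sub_right] at hGp hGv
    linarith
  have h1 : h ≤ inner ℝ g (x - z) := by
    have := inner_gradient_le_sub hconv hdiff hx hz.1
    rw [inner_sub_right] at this ⊢
    linarith
  have h2 : R * h ≤ m * Γ := by
    have h3 := mul_le_mul_of_nonneg_left (h1.trans (inner_sub_le_mul hR hw hzR hp hv)) hR.le
    have h4 := mul_le_mul_of_nonneg_right (mul_sum_max_le (z := z) hR hw) hΓ0
    rw [← mul_assoc] at h3
    exact h3.trans h4
  have hm2 : m ^ 2 ≤ s * (2 / α * h) := by
    refine (sum_abs_sq_le_nnz_mul x z).trans ?_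
    exact mul_le_mul (by exact_mod_cast hnnz) hdist (sq_nonneg _) (Nat.cast_nonneg _)
  have h5 : (R * h) ^ 2 ≤ s * (2 / α * h) * (2 * G) ^ 2 := by
    calc (R * h) ^ 2 ≤ (m * Γ) ^ 2 := pow_le_pow_left₀ (mul_nonneg hR.le hh0) h2 2
      _ = m ^ 2 * Γ ^ 2 := mul_pow _ _ _
      _ ≤ _ := mul_le_mul hm2 (pow_le_pow_left₀ hΓ0 hΓG 2) (sq_nonneg _)
        ((sq_nonneg _).trans hm2)
  rcases hh0.eq_or_lt with h0 | h0
  · rw [← h0, mul_zero]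
    positivity
  · refine le_of_mul_le_mul_right ?_ h0
    calc α * R ^ 2 * h * h = α * (R * h) ^ 2 := by ring
      _ ≤ α * (s * (2 / α * h) * (2 * G) ^ 2) := mul_le_mul_of_nonneg_left h5 hα.le
      _ = 8 * s * G ^ 2 * h := by field_simp; ring

end AFW

namespace AFW

open L1Problem

/-! ### One iteration -/

variable {n : ℕ} {f : EuclideanSpace ℝ (Fin n) → ℝ} {R β : ℝ} {w w' : Atom n → ℝ}

/-- The number of active atoms; for nonnegative weights these are the atoms of nonzero weight. -/
def activeCard (w : Atom n → ℝ) : ℕ := (Finset.univ.filter fun a => w a ≠ 0).card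

theorem IsWeights.exists_pos (hw : IsWeights w) : ∃ a, 0 < w a := by
  by_contra! h
  have h0 : ∑ a, w a ≤ 0 := Finset.sum_nonpos fun a _ => h a
  rw [hw.2] at h0
  linarith

theorem IsWeights.le_one (hw : IsWeights w) (a : Atom n) : w a ≤ 1 := by
  rw [← hw.2]
  exact Finset.single_le_sum (fun a _ => hw.1 a) (Finset.mem_univ a)

theorem IsWeights.eq_single (hw : IsWeights w) {a : Atom n} (ha : w a = 1) :
    w = Pi.single a 1 := by
  have h := Finset.add_sum_erase Finset.univ w (Finset.mem_univ a)
  rw [hw.2, ha, add_eq_left, Finset.sum_eq_zero_iff_of_nonneg fun b _ => hw.1 b] at h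
  ext b
  rcases eq_or_ne b a with rfl | hb
  · simp [ha]
  · rw [h b (by simp [hb]), Pi.single_eq_of_ne hb]

theorem isWeights_single (a : Atom n) : IsWeights (Pi.single a (1 : ℝ)) :=
  ⟨fun b => by rw [Pi.single_apply]; split_ifs <;> simp, by simp⟩

theorem activeCard_single (a : Atom n) : activeCard (Pi.single a (1 : ℝ)) = 1 := by
  simp [activeCard, Pi.single_apply, Finset.filter_eq']

theorem point_add_single (c δ : ℝ) (w : Atom n → ℝ) (p : Atom n) :
    point R (fun a => c * w a + if a = p then δ else 0) =
      c • point R w + δ • vertex R p := by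
  simp [point, add_smul, Finset.sum_add_distrib, Finset.smul_sum, smul_smul, ite_smul]

theorem sum_add_single (c δ : ℝ) (w : Atom n → ℝ) (p : Atom n) :
    ∑ a, (c * w a + if a = p then δ else 0) = c * ∑ a, w a + δ := by
  simp [Finset.sum_add_distrib, Finset.mul_sum]

theorem point_fwStep (γ : ℝ) (w : Atom n → ℝ) (p : Atom n) :
    point R (fun a => (1 - γ) * w a + if a = p then γ else 0) =
      point R w + γ • (vertex R p - point R w) := by
  rw [point_add_single]
  module

theorem point_awayStep (γ : ℝ) (w : Atom n → ℝ) (v : Atom n) :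
    point R (fun a => (1 + γ) * w a - if a = v then γ else 0) =
      point R w + γ • (point R w - vertex R v) := by
  have h := point_add_single (R := R) (1 + γ) (-γ) w v
  have he : (fun a => (1 + γ) * w a + if a = v then -γ else 0) =
      fun a => (1 + γ) * w a - if a = v then γ else 0 := by
    ext a
    split_ifs <;> ring
  rw [he] at h
  rw [h]
  module

theorem IsWeights.fwStep (hw : IsWeights w) {γ : ℝ} (hγ : γ ∈ Set.Icc (0 : ℝ) 1) (p : Atom n) :
    IsWeights (fun a => (1 - γ) * w a + if a = p then γ else 0) := by
  refine ⟨fun a => ?_, by rw [sum_add_single, hw.2]; ring⟩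
  have := mul_nonneg (sub_nonneg.2 hγ.2) (hw.1 a)
  have h0 := hγ.1
  dsimp only
  split_ifs <;> linarith

theorem IsWeights.awayStep (hw : IsWeights w) {v : Atom n} (hv : w v < 1) {γ : ℝ}
    (hγ : γ ∈ Set.Icc (0 : ℝ) (w v / (1 - w v))) :
    IsWeights (fun a => (1 + γ) * w a - if a = v then γ else 0) := by
  constructor
  · intro a
    have h1 := mul_nonneg (add_nonneg zero_le_one hγ.1) (hw.1 a)
    dsimp only
    split_ifs with ha
    · subst ha
      have h2 := (le_div_iff₀ (sub_pos.2 hv)).1 hγ.2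
      linarith
    · linarith
  · rw [Finset.sum_sub_distrib, ← Finset.mul_sum, hw.2]
    simp

/-- An away step is never taken at a vertex: there the away direction is zero, while the
Frank-Wolfe gap is nonnegative. -/
theorem IsWeights.lt_one_of_lt (hR : 0 < R) (hw : IsWeights w) {g : EuclideanSpace ℝ (Fin n)}
    {p v : Atom n} (hp : IsFWAtom R g p)
    (hdir : inner ℝ (-g) (vertex R p - point R w) < inner ℝ (-g) (point R w - vertex R v)) :
    w v < 1 := by
  refine lt_of_le_of_ne (hw.le_one v) fun hv => ?_
  have h1 := inner_vertex_le_of_mem hR hp (point_mem hR.le hw)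
  rw [hw.eq_single hv, point_single] at hdir h1
  rw [sub_self, inner_zero_right, inner_neg_left, inner_sub_right] at hdir
  linarith

theorem Step.isWeights (hR : 0 < R) (h : Step f R w w') (hw : IsWeights w) : IsWeights w' := by
  cases h with
  | frankWolfe p v γ hp hv hdir hγ => exact hw.fwStep hγ.1 p
  | away p v γ hp hv hdir hγ => exact hw.awayStep (hw.lt_one_of_lt hR hp hdir) hγ.1

/-- The effect of one iteration on the objective. Either the step is a drop step, which does not
increase the objective and removes an active atom, or at most one atom becomes active and the
objective decreases by at least an amount that depends on the larger directional gap `G`. The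
second term of the minimum is the optimal decrease of the quadratic upper bound; the first one
stands for the case that its minimizer is beyond the step size `1` of a Frank-Wolfe step. -/
theorem Step.progress (hR : 0 < R) (hβ : 0 < β)
    (hdiff : ∀ x ∈ l1Ball n R, DifferentiableAt ℝ f x)
    (hlip : GradLipschitzL1 f R β) (hw : IsWeights w) (h : Step f R w w') :
    (f (point R w') ≤ f (point R w) ∧ activeCard w' + 1 ≤ activeCard w) ∨
    (activeCard w' ≤ activeCard w + 1 ∧ ∃ (p v : Atom n) (G : ℝ),
      IsFWAtom R (gradient f (point R w)) p ∧ IsAwayAtom R w (gradient f (point R w)) v ∧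
      inner ℝ (-gradient f (point R w)) (vertex R p - point R w) ≤ G ∧
      inner ℝ (-gradient f (point R w)) (point R w - vertex R v) ≤ G ∧
      min (G / 2) (G ^ 2 / (8 * β * R ^ 2)) ≤ f (point R w) - f (point R w')) := by
  have hx := point_mem hR.le hw
  have hw' := h.isWeights hR hw
  have hx' := point_mem hR.le hw'
  have hβR : 0 < β * R ^ 2 := by positivity
  -- the step size at which the quadratic upper bound is minimal
  have hval : ∀ G : ℝ, -(G / (4 * β * R ^ 2)) * G + 2 * β * R ^ 2 * (G / (4 * β * R ^ 2)) ^ 2 =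
      -(G ^ 2 / (8 * β * R ^ 2)) := by
    intro G
    field_simp
    ring
  cases h with
  | frankWolfe p v γ hp hv hdir hγ =>
    right
    constructor
    · refine (Finset.card_le_card (t := insert p (Finset.univ.filter fun a => w a ≠ 0))
        fun a ha => ?_).trans (Finset.card_insert_le _ _)
      simp only [Finset.mem_filter, Finset.mem_univ, true_and, Finset.mem_insert] at ha ⊢
      by_contra! hne
      simp [hne.1, hne.2] at ha
    · refine ⟨p, v, _, hp, hv, le_rfl, hdir, ?_⟩
      set G := inner ℝ (-gradient f (point R w)) (vertex R p - point R w) with hG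
      have hG0 : 0 ≤ G := by
        have := inner_vertex_le_of_mem hR hp hx
        rw [hG, inner_neg_left, inner_sub_right]
        linarith
      have hmax : point R w + (1 : ℝ) • (vertex R p - point R w) ∈ l1Ball n R := by
        simpa using vertex_mem hR.le p
      have hle := fun η => hγ.le_quadratic hdiff hlip hβ.le hx
        (l1norm_sub_le_two_mul (vertex_mem hR.le p) hx) hmax (η := η)
      rw [point_fwStep]
      rcases le_total G (4 * β * R ^ 2) with hc | hc
      · refine (min_le_right _ _).trans ?_
        have h1 := hle (G / (4 * β * R ^ 2))
          ⟨by positivity, (div_le_one (by positivity)).2 hc⟩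
        have h2 := hval G
        linarith
      · refine (min_le_left _ _).trans ?_
        have h1 := hle 1 ⟨zero_le_one, le_rfl⟩
        linarith
  | away p v γ hp hv hdir hγ =>
    have hlt := hw.lt_one_of_lt hR hp hdir
    have hγmax0 : 0 ≤ w v / (1 - w v) := hγ.1.1.trans hγ.1.2
    have hsub : ∀ a, (1 + γ) * w a - (if a = v then γ else 0) ≠ 0 → w a ≠ 0 := by
      intro a ha h0
      have hav : a ≠ v := fun hav => hv.1.ne' (hav ▸ h0)
      simp [h0, hav] at ha
    rcases hγ.1.2.eq_or_lt with hdrop | hgood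
    · left
      refine ⟨by rw [point_awayStep]; exact hγ.le, ?_⟩
      refine Finset.card_lt_card (Finset.ssubset_iff_of_subset (fun a ha => ?_) |>.2
        ⟨v, by simpa using hv.1.ne', ?_⟩)
      · simpa using hsub a (by simpa using ha)
      · have h1 : 1 - w v ≠ 0 := (sub_pos.2 hlt).ne'
        simp only [Finset.mem_filter, Finset.mem_univ, true_and, if_true, not_not]
        rw [hdrop]
        field_simp
        ring
    · right
      constructor
      · refine (Finset.card_le_card fun a ha => ?_).trans (Nat.le_succ _)
        simpa using hsub a (by simpa using ha)
      · refine ⟨p, v, _, hp, hv, hdir.le, le_rfl, (min_le_right _ _).trans ?_⟩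
        set G := inner ℝ (-gradient f (point R w)) (point R w - vertex R v) with hG
        have hG0 : 0 ≤ G := by
          have := inner_vertex_le_of_mem hR hp hx
          rw [inner_neg_left, inner_sub_right] at hdir
          linarith
        have hmax : point R w + (w v / (1 - w v)) • (point R w - vertex R v) ∈ l1Ball n R := by
          rw [← point_awayStep]
          exact point_mem hR.le (hw.awayStep hlt ⟨hγmax0, le_rfl⟩)
        have hd := l1norm_sub_le_two_mul hx (vertex_mem hR.le v)
        have hstep := hγ.le_step hdiff hlip hβ hR hx hd hmax hgood
        have h1 := hγ.le_quadratic hdiff hlip hβ.le hx hd hmax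
          (η := G / (4 * β * R ^ 2)) ⟨by positivity, hstep.trans hγ.1.2⟩
        have h2 := hval G
        rw [point_awayStep]
        linarith

/-- The first step, which starts at a vertex, is a Frank-Wolfe step with the unit step size
admissible, so that the primal gap is bounded afterwards. -/
theorem Step.first (hR : 0 < R) (hβ : 0 < β) (hconv : ConvexOn ℝ (l1Ball n R) f)
    (hdiff : ∀ x ∈ l1Ball n R, DifferentiableAt ℝ f x)
    (hlip : GradLipschitzL1 f R β) {a : Atom n} (h : Step f R (Pi.single a 1) w')
    {y : EuclideanSpace ℝ (Fin n)} (hy : y ∈ l1Ball n R) :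
    f (point R w') - f y ≤ 2 * β * R ^ 2 ∧ activeCard w' ≤ 2 := by
  have hw := isWeights_single a
  have hx := point_mem hR.le hw
  have hcard : activeCard w' ≤ 2 := by
    have h1 := activeCard_single a
    rcases h.progress hR hβ hdiff hlip hw with h' | h' <;> omega
  refine ⟨?_, hcard⟩
  cases h with
  | frankWolfe p v γ hp hv hdir hγ =>
    have hmax : point R (Pi.single a 1) + (1 : ℝ) • (vertex R p - point R (Pi.single a 1)) ∈
        l1Ball n R := by
      simpa using vertex_mem hR.le p
    have h1 := hγ.le_quadratic hdiff hlip hβ.le hx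
        (l1norm_sub_le_two_mul (vertex_mem hR.le p) hx) hmax ⟨zero_le_one, le_rfl⟩
    have h2 := sub_le_inner hR hconv hdiff hp hx hy
    rw [point_fwStep]
    linarith
  | away p v γ hp hv hdir hγ =>
    have hlt := hw.lt_one_of_lt hR hp hdir
    have hva : v = a := by
      by_contra hva
      have := hv.1
      rw [Pi.single_eq_of_ne hva] at this
      exact lt_irrefl _ this
    simp [hva] at hlt

end AFW

namespace AFW

open L1Problem

/-! ### The number of iterations -/

/-- The assumptions on the objective: a smooth convex function with quadratic growth on the ball
of radius `R`, whose minimizers there are `s`-sparse boundary points. -/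
structure SparseProblem {n : ℕ} (f : EuclideanSpace ℝ (Fin n) → ℝ) (R β α : ℝ) (s : ℕ) :
    Prop where
  R_pos : 0 < R
  β_pos : 0 < β
  α_pos : 0 < α
  convex : ConvexOn ℝ (l1Ball n R) f
  diff : ∀ x ∈ l1Ball n R, DifferentiableAt ℝ f x
  lip : GradLipschitzL1 f R β
  growth : QuadraticGrowthL2 f R α
  sparse : SparseBoundaryOptima f R s

variable {n s : ℕ} {f : EuclideanSpace ℝ (Fin n) → ℝ} {R β α ε κ : ℝ} {w : ℕ → Atom n → ℝ}

theorem SparseProblem.exists_isOptimal (h : SparseProblem f R β α s) : ∃ y, IsOptimal f R y := by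
  obtain ⟨z, hz, -⟩ := h.growth 0 (by simpa [l1Ball, l1norm] using h.R_pos.le)
  exact ⟨z, hz⟩

theorem IsRun.isWeights (hR : 0 < R) (h : IsRun f R w) (t : ℕ) : IsWeights (w t) := by
  induction t with
  | zero =>
    obtain ⟨a, ha⟩ := h.1
    rw [ha]
    exact isWeights_single a
  | succ t ih => exact (h.2 t).isWeights hR ih

theorem div_le_min_of_gap {G h : ℝ} (hR : 0 < R) (hβ : 0 < β) (hα : 0 < α) (hκ : 1 ≤ κ)
    (hκs : β * s / α ≤ κ) (h0 : 0 ≤ h) (hG : h ≤ G) (hsq : α * R ^ 2 * h ≤ 8 * s * G ^ 2) :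
    h / (64 * κ) ≤ min (G / 2) (G ^ 2 / (8 * β * R ^ 2)) := by
  have hκ0 : 0 < κ := by linarith
  refine le_min ?_ ?_
  · rw [div_le_div_iff₀ (by positivity) two_pos]
    nlinarith
  · rw [div_le_div_iff₀ (by positivity) (by positivity)]
    have h1 : β * s ≤ κ * α := (div_le_iff₀ hα).1 hκs
    have h2 := mul_le_mul_of_nonneg_left hsq hβ.le
    have h3 := mul_le_mul_of_nonneg_right h1 (sq_nonneg G)
    refine le_of_mul_le_mul_left ?_ hα
    nlinarith

/-- Linear convergence along a run. The exponent `m` counts the steps after the first one that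
are not drop steps; as every drop step removes an active atom and every other step adds at most
one, these are about half of all steps or more. If the stopping test has failed so far, then each of
them has decreased the objective by at least the quantity on the left of the last inequality. -/
theorem IsRun.exists_bound (hP : SparseProblem f R β α s) (hrun : IsRun f R w) (hε : 0 < ε)
    (hκ : 1 ≤ κ) (hκs : β * s / α ≤ κ) {y : EuclideanSpace ℝ (Fin n)} (hy : IsOptimal f R y)
    (t : ℕ) : ∃ m : ℕ,
      f (point R (w (t + 1))) - f y ≤ 2 * β * R ^ 2 * (1 - 1 / (64 * κ)) ^ m ∧
      activeCard (w (t + 1)) + t ≤ 2 * m + 2 ∧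
      ((∀ k ≤ t, ¬ GapAtMost f R ε (point R (w k))) → 1 ≤ m →
        min (ε / 2) (ε ^ 2 / (8 * β * R ^ 2)) ≤
          2 * β * R ^ 2 * (1 - 1 / (64 * κ)) ^ (m - 1)) := by
  have hR := hP.R_pos
  have hβ := hP.β_pos
  have hq : 0 ≤ 1 - 1 / (64 * κ) := by
    rw [sub_nonneg, div_le_one (by linarith)]
    linarith
  induction t with
  | zero =>
    obtain ⟨a, ha⟩ := hrun.1
    have h := hrun.2 0
    rw [ha] at h
    obtain ⟨h1, h2⟩ := h.first hR hβ hP.convex hP.diff hP.lip hy.1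
    exact ⟨0, by simpa using h1, by simpa using h2, fun _ h0 => absurd h0 (by norm_num)⟩
  | succ t ih =>
    obtain ⟨m, hm, hcard, hgap⟩ := ih
    have hw := hrun.isWeights hR (t + 1)
    have hx := point_mem hR.le hw
    rcases (hrun.2 (t + 1)).progress hR hβ hP.diff hP.lip hw with
      ⟨hle, hdrop⟩ | ⟨hcard', p, v, G, hp, hv, hGp, hGv, hdec⟩
    · exact ⟨m, by linarith, by omega, fun hk => hgap fun k hkt => hk k (by omega)⟩
    · have h0 : 0 ≤ f (point R (w (t + 1))) - f y := sub_nonneg.2 (hy.2 _ hx)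
      have h1 := div_le_min_of_gap hR hβ hP.α_pos hκ hκs h0
        ((sub_le_inner hR hP.convex hP.diff hp hx hy.1).trans hGp)
        (primal_gap_le_directional_gap_sq hR hP.α_pos hP.convex hP.diff hP.growth hP.sparse hw
          hy hp hv hGp hGv)
      have h2 := mul_le_mul_of_nonneg_right hm hq
      refine ⟨m + 1, ?_, by omega, fun hk _ => ?_⟩
      · calc f (point R (w (t + 1 + 1))) - f y
            ≤ (f (point R (w (t + 1))) - f y) * (1 - 1 / (64 * κ)) := by
              rw [mul_one_sub, mul_one_div]
              linarith
          _ ≤ _ := h2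
          _ = _ := by ring
      · have hnot := hk (t + 1) le_rfl
        simp only [GapAtMost, not_forall, not_le] at hnot
        obtain ⟨a, ha⟩ := hnot
        have hεG : ε ≤ G := by
          have h3 := hp a
          rw [inner_neg_left, inner_sub_right] at ha hGp
          linarith
        have h4 := hy.2 _ (point_mem hR.le (hrun.isWeights hR (t + 1 + 1)))
        calc min (ε / 2) (ε ^ 2 / (8 * β * R ^ 2))
            ≤ min (G / 2) (G ^ 2 / (8 * β * R ^ 2)) := by gcongr
          _ ≤ f (point R (w (t + 1))) - f y := by linarith
          _ ≤ _ := hm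

theorem pow_le_exp_neg (hκ : 1 ≤ κ) (m : ℕ) :
    (1 - 1 / (64 * κ)) ^ m ≤ Real.exp (-(m / (64 * κ))) := by
  have hq : 0 ≤ 1 - 1 / (64 * κ) := by
    rw [sub_nonneg, div_le_one (by linarith)]
    linarith
  refine (pow_le_pow_left₀ hq (Real.one_sub_le_exp_neg _) m).trans_eq ?_
  rw [← Real.exp_nat_mul]
  congr 1
  ring

/-- After `6 · 64 κ max 1 (log (β R² / ε))` contractions by `1 - 1 / (64 κ)`, the initial bound
`2 β R²` is so small that the stopping test must succeed. -/
theorem mul_pow_lt_min {b : ℝ} (hb : 0 < b) (hε : 0 < ε) (hκ : 1 ≤ κ) {m : ℕ}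
    (hm : 384 * (κ * max 1 (Real.log (b / ε))) ≤ m) :
    2 * b * (1 - 1 / (64 * κ)) ^ m < min (ε / 2) (ε ^ 2 / (8 * b)) := by
  set ℓ := Real.log (b / ε) with hℓ
  have hκ0 : 0 < κ := by linarith
  have h1 : 6 * max 1 ℓ ≤ m / (64 * κ) := by
    rw [le_div_iff₀ (by positivity)]
    linarith
  have hE : b = ε * Real.exp ℓ := by
    rw [hℓ, Real.exp_log (by positivity)]
    field_simp
  have hL1 := le_max_left 1 ℓ
  have hL2 := le_max_right 1 ℓ
  have he2 : (2 : ℝ) < Real.exp 1 := by linarith [Real.exp_one_gt_d9]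
  have he4 : (4 : ℝ) < Real.exp 2 := by
    rw [show (2 : ℝ) = 1 + 1 by norm_num, Real.exp_add]
    nlinarith
  have he16 : (16 : ℝ) < Real.exp 4 := by
    rw [show (4 : ℝ) = 2 + 2 by norm_num, Real.exp_add]
    nlinarith
  have hpow := pow_le_exp_neg hκ m
  refine lt_min ?_ ?_
  · have h2 : 4 * Real.exp (ℓ + -(m / (64 * κ))) < 1 := by
      have h3 : Real.exp (ℓ + -(m / (64 * κ))) ≤ Real.exp (-2) :=
        Real.exp_le_exp.2 (by linarith)
      rw [Real.exp_neg] at h3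
      have h4 : 4 * (Real.exp 2)⁻¹ < 1 := by
        rw [← div_eq_mul_inv, div_lt_one (by positivity)]
        exact he4
      linarith
    rw [Real.exp_add] at h2
    calc 2 * b * (1 - 1 / (64 * κ)) ^ m ≤ 2 * b * Real.exp (-(m / (64 * κ))) := by gcongr
      _ = ε / 2 * (4 * (Real.exp ℓ * Real.exp (-(m / (64 * κ))))) := by rw [hE]; ring
      _ < ε / 2 * 1 := by gcongr
      _ = _ := mul_one _
  · have h2 : 16 * Real.exp (ℓ + ℓ + -(m / (64 * κ))) < 1 := by
      have h3 : Real.exp (ℓ + ℓ + -(m / (64 * κ))) ≤ Real.exp (-4) :=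
        Real.exp_le_exp.2 (by linarith)
      rw [Real.exp_neg] at h3
      have h4 : 16 * (Real.exp 4)⁻¹ < 1 := by
        rw [← div_eq_mul_inv, div_lt_one (by positivity)]
        exact he16
      linarith
    rw [Real.exp_add, Real.exp_add] at h2
    rw [lt_div_iff₀ (by positivity)]
    calc 2 * b * (1 - 1 / (64 * κ)) ^ m * (8 * b)
        ≤ 2 * b * Real.exp (-(m / (64 * κ))) * (8 * b) := by gcongr
      _ = ε ^ 2 * (16 * (Real.exp ℓ * Real.exp ℓ * Real.exp (-(m / (64 * κ))))) := by
        rw [hE]; ring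
      _ < ε ^ 2 * 1 := by gcongr
      _ = _ := mul_one _

/-- The bound on the number of iterations, for both the primal gap and the stopping test. -/
theorem IsRun.iteration_bound (hP : SparseProblem f R β α s) (hrun : IsRun f R w) (hε : 0 < ε)
    (hκ : 1 ≤ κ) (hκs : β * s / α ≤ κ) :
    (∀ t : ℕ, 1000 * (κ * max 1 (Real.log (β * R ^ 2 / ε))) ≤ t →
      IsApproxOptimal f R ε (point R (w t))) ∧
    ∃ t : ℕ, (t : ℝ) ≤ 1000 * (κ * max 1 (Real.log (β * R ^ 2 / ε))) ∧
      ReturnsAt f R ε w t ∧ IsApproxOptimal f R ε (point R (w t)) := by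
  have hR := hP.R_pos
  have hβ := hP.β_pos
  have : Nonempty (Atom n) := ⟨hrun.1.choose⟩
  obtain ⟨y, hy⟩ := hP.exists_isOptimal
  set N := κ * max 1 (Real.log (β * R ^ 2 / ε)) with hN
  have hN1 : 1 ≤ N := one_le_mul_of_one_le_of_one_le hκ (le_max_left _ _)
  have hsmall : ∀ m : ℕ, 384 * N ≤ m → 2 * β * R ^ 2 * (1 - 1 / (64 * κ)) ^ m <
      min (ε / 2) (ε ^ 2 / (8 * β * R ^ 2)) := by
    intro m hm
    have h := mul_pow_lt_min (b := β * R ^ 2) (by positivity) hε hκ hm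
    simpa only [← mul_assoc] using h
  constructor
  · intro t ht
    obtain ⟨t, rfl⟩ : ∃ k, t = k + 1 := Nat.exists_eq_succ_of_ne_zero (by
      rintro rfl
      push_cast at ht
      linarith)
    obtain ⟨m, hm, hcard, -⟩ := hrun.exists_bound hP hε hκ hκs hy t
    have hcard' : (t : ℝ) ≤ 2 * m + 2 := by exact_mod_cast (Nat.le_add_left _ _).trans hcard
    push_cast at ht
    have h1 := (hsmall m (by linarith)).trans_le (min_le_left _ _)
    refine ⟨point_mem hR.le (hrun.isWeights hR _), fun z hz => ?_⟩
    have h2 := hy.2 z hz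
    linarith
  · have hex : ∃ t : ℕ, t ≤ ⌊1000 * N⌋₊ ∧ GapAtMost f R ε (point R (w t)) := by
      by_contra! hno
      obtain ⟨m, -, hcard, hthr⟩ := hrun.exists_bound hP hε hκ hκs hy ⌊1000 * N⌋₊
      have hcard' : ((⌊1000 * N⌋₊ : ℕ) : ℝ) ≤ 2 * m + 2 := by
        exact_mod_cast (Nat.le_add_left _ _).trans hcard
      have hfl := Nat.lt_floor_add_one (1000 * N)
      have hm1 : 1 ≤ m := by
        have : (1 : ℝ) ≤ m := by linarith
        exact_mod_cast this
      have h1 := hsmall (m - 1) (by push_cast [Nat.cast_sub hm1]; linarith)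
      exact absurd (hthr hno hm1) (not_le.2 h1)
    classical
    obtain ⟨t, ht, hgap⟩ := hex
    have hex' : ∃ t, GapAtMost f R ε (point R (w t)) := ⟨t, hgap⟩
    refine ⟨Nat.find hex', ?_, ⟨Nat.find_spec hex', fun k hk => Nat.find_min hex' hk⟩, ?_⟩
    · exact (Nat.le_floor_iff (by linarith)).1 ((Nat.find_min' hex' hgap).trans ht)
    · exact (Nat.find_spec hex').isApproxOptimal hR hP.convex hP.diff
        (point_mem hR.le (hrun.isWeights hR _))

end AFW

namespace RealRAM

/-! ### Running times of real-RAM programs -/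

/-- Programs without loops. -/
def Prog.LoopFree : Prog → Prop
  | .skip => True
  | .setN _ _ => True
  | .setR _ _ _ => True
  | .seq p q => p.LoopFree ∧ q.LoopFree
  | .branch _ p q => p.LoopFree ∧ q.LoopFree
  | .loop _ _ => False

/-- A bound on the running time of a loop-free program; at a branch both alternatives are
counted. -/
def Prog.cost : Prog → ℕ
  | .skip => 1
  | .setN _ e => e.cost + 1
  | .setR _ idx e => idx.cost + e.cost + 1
  | .seq p q => p.cost + q.cost
  | .branch c p q => c.cost + 1 + (p.cost + q.cost)
  | .loop _ _ => 0

open Classical in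
/-- The memory transformation computed by a loop-free program. -/
def Prog.sem : Prog → Mem → Mem
  | .skip, σ => σ
  | .setN i e, σ => σ.setN i (e.eval σ)
  | .setR a idx e, σ => σ.setR a (idx.eval σ) (e.eval σ)
  | .seq p q, σ => q.sem (p.sem σ)
  | .branch c p q, σ => if c.holds σ then p.sem σ else q.sem σ
  | .loop _ _, σ => σ

theorem Prog.LoopFree.exec {p : Prog} (h : p.LoopFree) (σ : Mem) :
    ∃ t ≤ p.cost, Exec p σ (p.sem σ) t := by
  induction p generalizing σ with
  | skip => exact ⟨_, le_rfl, .skip σ⟩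
  | setN i e => exact ⟨_, le_rfl, .setN σ i e⟩
  | setR a idx e => exact ⟨_, le_rfl, .setR σ a idx e⟩
  | seq p q ihp ihq =>
    obtain ⟨t, ht, hp⟩ := ihp h.1 σ
    obtain ⟨u, hu, hq⟩ := ihq h.2 (p.sem σ)
    exact ⟨t + u, Nat.add_le_add ht hu, .seq hp hq⟩
  | branch c p q ihp ihq =>
    simp only [Prog.sem, Prog.cost]
    split_ifs with hc
    · obtain ⟨t, ht, hp⟩ := ihp h.1 σ
      exact ⟨_, by omega, .branch_true hc hp⟩
    · obtain ⟨t, ht, hq⟩ := ihq h.2 σ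
      exact ⟨_, by omega, .branch_false hc hq⟩
  | loop c p => exact h.elim

/-- Started in `σ`, the program `p` halts after at most `T` steps in a memory that satisfies
`Q`. -/
def Runs (p : Prog) (σ : Mem) (T : ℕ) (Q : Mem → Prop) : Prop :=
  ∃ τ t, Exec p σ τ t ∧ t ≤ T ∧ Q τ

variable {p q : Prog} {σ : Mem} {T U : ℕ} {P Q : Mem → Prop}

theorem Runs.mono (h : Runs p σ T P) (hTU : T ≤ U) (hPQ : ∀ τ, P τ → Q τ) : Runs p σ U Q := by
  obtain ⟨τ, t, he, ht, hP⟩ := h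
  exact ⟨τ, t, he, ht.trans hTU, hPQ τ hP⟩

theorem Runs.seq (hp : Runs p σ T P) (hq : ∀ τ, P τ → Runs q τ U Q) :
    Runs (.seq p q) σ (T + U) Q := by
  obtain ⟨τ, t, he, ht, hP⟩ := hp
  obtain ⟨υ, u, he', hu, hQ⟩ := hq τ hP
  exact ⟨υ, t + u, he.seq he', Nat.add_le_add ht hu, hQ⟩

theorem Prog.LoopFree.runs (h : p.LoopFree) (hQ : Q (p.sem σ)) (hT : p.cost ≤ T) :
    Runs p σ T Q := by
  obtain ⟨t, ht, he⟩ := h.exec σ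
  exact ⟨_, t, he, ht.trans hT, hQ⟩

/-- Loops that count the variable `i` from `0` up to the value `m` of `e`, with an
invariant `I`. -/
theorem Runs.forLoop {i : ℕ} {e : NExp} (I : ℕ → Mem → Prop) (m K : ℕ) (hfree : p.LoopFree)
    (hK : p.cost + e.cost + 3 ≤ K) (hI : ∀ k τ, I k τ → τ.nat i = k ∧ e.eval τ = m)
    (h0 : I 0 σ) (hstep : ∀ k < m, ∀ τ, I k τ → I (k + 1) (p.sem τ)) :
    Runs (.loop (.ltN (.var i) e) p) σ ((m + 1) * K) (I m) := by
  have key : ∀ d k τ, k + d = m → I k τ →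
      Runs (.loop (.ltN (.var i) e) p) τ ((d + 1) * K) (I m) := by
    intro d
    induction d with
    | zero =>
      intro k τ hk hIk
      obtain ⟨h1, h2⟩ := hI k τ hIk
      refine ⟨τ, _, .loop_false ?_, ?_, ?_⟩
      · simp only [BExp.holds, NExp.eval]
        omega
      · simp only [BExp.cost, NExp.cost]
        omega
      · rwa [← hk]
    | succ d ih =>
      intro k τ hk hIk
      obtain ⟨h1, h2⟩ := hI k τ hIk
      obtain ⟨t, ht, he⟩ := hfree.exec τ
      obtain ⟨υ, u, he', hu, hQ⟩ := ih (k + 1) (p.sem τ) (by omega) (hstep k (by omega) τ hIk)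
      refine ⟨υ, _, .loop_true ?_ he he', ?_, hQ⟩
      · simp only [BExp.holds, NExp.eval]
        omega
      · have h3 : (d + 1 + 1) * K = (d + 1) * K + K := by ring
        simp only [BExp.cost, NExp.cost]
        omega
  exact key m 0 σ (by omega) h0

/-- A loop runs through a given sequence of memories as long as its test holds. -/
theorem exec_loop {c : BExp} {σ : ℕ → Mem} (t : ℕ) (hc : ∀ k < t, c.holds (σ k))
    (ht : ¬ c.holds (σ t)) (hexec : ∀ k, ∃ u ≤ U, Exec p (σ k) (σ (k + 1)) u) :
    ∃ T ≤ (t + 1) * (U + c.cost + 1), Exec (.loop c p) (σ 0) (σ t) T := by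
  induction t generalizing σ with
  | zero => exact ⟨_, by omega, .loop_false ht⟩
  | succ t ih =>
    obtain ⟨T, hT, he⟩ := ih (σ := fun k => σ (k + 1)) (fun k hk => hc (k + 1) (by omega)) ht
      (fun k => hexec (k + 1))
    obtain ⟨u, hu, he'⟩ := hexec 0
    refine ⟨_, ?_, .loop_true (hc 0 (by omega)) he' he⟩
    have h3 : (t + 1 + 1) * (U + c.cost + 1) = (t + 1) * (U + c.cost + 1) + (U + c.cost + 1) := by
      ring
    omega

@[simp] theorem Mem.setN_arr (σ : Mem) (i k : ℕ) : (σ.setN i k).arr = σ.arr := rfl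

@[simp] theorem Mem.setR_nat (σ : Mem) (a k : ℕ) (r : ℝ) : (σ.setR a k r).nat = σ.nat := rfl

@[simp] theorem Mem.setN_nat (σ : Mem) (i k j : ℕ) :
    (σ.setN i k).nat j = if j = i then k else σ.nat j := by
  simp [Mem.setN, Function.update_apply]

@[simp] theorem Mem.setR_arr (σ : Mem) (a k : ℕ) (r : ℝ) (b : ℕ) :
    (σ.setR a k r).arr b = if b = a then Function.update (σ.arr a) k r else σ.arr b := by
  simp [Mem.setR, Function.update_apply]

/-! ### The program -/

/-! Variable `0` holds `n`, variable `1` is the loop counter, variables `2`, `3` and `4` hold the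
numbers of the Frank-Wolfe atom, of the away atom and of the one of the two that is chosen for the
step, variable `5` holds the coordinate of the chosen atom, and variable `6` the offset of the
corresponding row of `A`. The atoms `R eᵢ` and `-R eᵢ` have the numbers `i` and `i + n`.

Besides the input arrays `0`, `1`, `2`, the program keeps the iterate `x` in array `3`, the weights
in array `4`, the vector `A x` in array `5`, and the values of the linear function `⟨∇f(x), ·⟩` at
the atoms in array `6`. The entries of array `7` are, in this order: `⟨∇f(x), x⟩`, `⟨x, A x⟩`, the
sign `1` or `-1` of the step (towards or away from the chosen atom), the directional gap, the
maximal step size, the signed radius of the chosen atom, the curvature along the direction, and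
the signed step size. -/

namespace AFWProg

abbrev nV : NExp := .var 0

abbrev iV : NExp := .var 1

abbrev pV : NExp := .var 2

abbrev vV : NExp := .var 3

abbrev kV : NExp := .var 4

abbrev jV : NExp := .var 5

abbrev oV : NExp := .var 6

/-- The entry `k` of the array of scalars. -/
abbrev reg (k : ℕ) : RExp := .cell 7 (.const k)

/-- The radius. -/
abbrev radius : RExp := .cell 2 (.const 0)

/-- Increments the loop counter. -/
abbrev incr : Prog := .setN 1 (.add iV (.const 1))

/-- Computes one coordinate of the iterate, the values at the two atoms of this coordinate, and the
next partial sums of `⟨∇f(x), x⟩` and `⟨x, A x⟩`. -/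
def evalBody : Prog :=
  .seq (.setR 3 iV (.mul radius (.sub (.cell 4 iV) (.cell 4 (.add iV nV)))))
  (.seq (.setR 6 iV (.mul radius (.add (.cell 5 iV) (.cell 1 iV))))
  (.seq (.setR 6 (.add iV nV) (.sub (.const 0) (.cell 6 iV)))
  (.seq (.setR 7 (.const 0)
    (.add (reg 0) (.mul (.add (.cell 5 iV) (.cell 1 iV)) (.cell 3 iV))))
  (.seq (.setR 7 (.const 1) (.add (reg 1) (.mul (.cell 5 iV) (.cell 3 iV)))) incr))))

/-- Compares one atom with the best ones found so far. The search for the away atom starts at the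
atom `0`, which may be inactive and is then replaced by the first active one. -/
def searchBody : Prog :=
  .seq (.branch (.ltR (.cell 6 iV) (.cell 6 pV)) (.setN 2 iV) .skip)
  (.seq (.branch (.conj (.ltR (.const 0) (.cell 4 iV))
      (.neg (.conj (.ltR (.const 0) (.cell 4 vV)) (.neg (.ltR (.cell 6 vV) (.cell 6 iV))))))
    (.setN 3 iV) .skip) incr)

/-- Computes the iterate, the gradient and its extreme atoms from the weights and `A x`. -/
def scan : Prog :=
  .seq (.seq (.setR 7 (.const 0) (.const 0)) (.seq (.setR 7 (.const 1) (.const 0))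
    (.setN 1 (.const 0))))
  (.seq (.loop (.ltN iV nV) evalBody)
  (.seq (.seq (.setN 1 (.const 0)) (.seq (.setN 2 (.const 0)) (.setN 3 (.const 0))))
  (.loop (.ltN iV (.add nV nV)) searchBody)))

/-- Decides between a Frank-Wolfe step and an away step. -/
def choose : Prog :=
  .branch (.ltR (.sub (reg 0) (.cell 6 pV)) (.sub (.cell 6 vV) (reg 0)))
    (.seq (.setN 4 vV) (.seq (.setR 7 (.const 2) (.const (-1)))
      (.seq (.setR 7 (.const 3) (.sub (.cell 6 vV) (reg 0)))
      (.setR 7 (.const 4) (.div (.cell 4 vV) (.sub (.const 1) (.cell 4 vV)))))))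
    (.seq (.setN 4 pV) (.seq (.setR 7 (.const 2) (.const 1))
      (.seq (.setR 7 (.const 3) (.sub (reg 0) (.cell 6 pV)))
      (.setR 7 (.const 4) (.const 1)))))

/-- Computes the coordinate and the signed radius of the chosen atom. -/
def locate : Prog :=
  .seq (.branch (.ltN kV nV)
    (.seq (.setN 5 kV) (.setR 7 (.const 5) radius))
    (.seq (.setN 5 (.sub kV nV)) (.setR 7 (.const 5) (.sub (.const 0) radius))))
  (.seq (.setN 6 (.const 0)) (.setN 1 (.const 0)))

/-- Advances the row offset by one row; there is no multiplication of indices. -/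
def offsetBody : Prog := .seq (.setN 6 (.add oV nV)) incr

/-- Exact line search. The curvature along the direction is computed in constant time from
`⟨x, A x⟩` and `A x`. -/
def lineSearch : Prog :=
  .seq (.setR 7 (.const 6) (.add (.sub (.mul (.mul (reg 5) (reg 5)) (.cell 0 (.add oV jV)))
    (.mul (.mul (.const 2) (reg 5)) (.cell 5 jV))) (reg 1)))
  (.seq (.branch (.conj (.ltR (.const 0) (reg 6)) (.ltR (.div (reg 3) (reg 6)) (reg 4)))
    (.setR 7 (.const 7) (.mul (reg 2) (.div (reg 3) (reg 6))))
    (.setR 7 (.const 7) (.mul (reg 2) (reg 4))))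
  (.setN 1 (.const 0)))

/-- Updates one entry of `A x`; the row of the symmetric matrix `A` serves as its column. -/
def imageBody : Prog :=
  .seq (.setR 5 iV (.add (.mul (.sub (.const 1) (reg 7)) (.cell 5 iV))
    (.mul (reg 7) (.mul (reg 5) (.cell 0 (.add oV iV)))))) incr

/-- Rescales one weight. -/
def weightBody : Prog :=
  .seq (.setR 4 iV (.mul (.sub (.const 1) (reg 7)) (.cell 4 iV))) incr

/-- Performs the step towards or away from the chosen atom. -/
def move : Prog :=
  .seq (.loop (.ltN iV jV) offsetBody)
  (.seq lineSearch
  (.seq (.loop (.ltN iV nV) imageBody)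
  (.seq (.setN 1 (.const 0))
  (.seq (.loop (.ltN iV (.add nV nV)) weightBody)
  (.setR 4 kV (.add (.cell 4 kV) (reg 7)))))))

/-- Starts at the atom `R e₀`. -/
def start : Prog :=
  .seq (.setR 4 (.const 0) (.const 1))
  (.loop (.ltN iV nV) (.seq (.setR 5 iV (.mul radius (.cell 0 iV))) incr))

/-- One iteration. -/
def iteration : Prog := .seq choose (.seq locate (.seq move scan))

/-- The stopping test fails. -/
def test : BExp := .ltR (.cell 2 (.const 1)) (.sub (reg 0) (.cell 6 pV))

/-- The away-steps Frank-Wolfe algorithm for quadratics. -/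
def program : Prog := .seq (.seq start scan) (.loop test iteration)

/-- The variable `0` holds `N`, and the input arrays hold `M`, `B` and `S`. -/
structure Base (N : ℕ) (M B S : ℕ → ℝ) (σ : Mem) : Prop where
  nat0 : σ.nat 0 = N
  arr0 : σ.arr 0 = M
  arr1 : σ.arr 1 = B
  arr2 : σ.arr 2 = S

variable {N : ℕ} {M B S W V : ℕ → ℝ}

theorem runs_eval (h : Base N M B S σ) (hW : σ.arr 4 = W) (hV : σ.arr 5 = V)
    (h1 : σ.nat 1 = 0) (h70 : σ.arr 7 0 = 0) (h71 : σ.arr 7 1 = 0) :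
    Runs (.loop (.ltN iV nV) evalBody) σ ((N + 1) * 100) fun τ =>
      Base N M B S τ ∧ τ.arr 4 = W ∧ τ.arr 5 = V ∧
      (∀ i < N, τ.arr 3 i = S 0 * (W i - W (i + N)) ∧ τ.arr 6 i = S 0 * (V i + B i) ∧
        τ.arr 6 (i + N) = -(S 0 * (V i + B i))) ∧
      τ.arr 7 0 = ∑ i ∈ Finset.range N, (V i + B i) * (S 0 * (W i - W (i + N))) ∧
      τ.arr 7 1 = ∑ i ∈ Finset.range N, V i * (S 0 * (W i - W (i + N))) := by
  refine (Runs.forLoop (fun k τ => τ.nat 1 = k ∧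
      Base N M B S τ ∧ τ.arr 4 = W ∧ τ.arr 5 = V ∧
      (∀ i < k, τ.arr 3 i = S 0 * (W i - W (i + N)) ∧ τ.arr 6 i = S 0 * (V i + B i) ∧
        τ.arr 6 (i + N) = -(S 0 * (V i + B i))) ∧
      τ.arr 7 0 = ∑ i ∈ Finset.range k, (V i + B i) * (S 0 * (W i - W (i + N))) ∧
      τ.arr 7 1 = ∑ i ∈ Finset.range k, V i * (S 0 * (W i - W (i + N)))) N 100
    (by simp [evalBody, Prog.LoopFree]) (by decide) ?_ ?_ ?_).mono le_rfl (fun τ h => h.2)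
  · rintro k τ ⟨hk, hB, -⟩
    exact ⟨hk, hB.nat0⟩
  · exact ⟨h1, h, hW, hV, by simp, by simpa, by simpa⟩
  · rintro k hkN τ ⟨hk, ⟨hN, hM, hB, hS⟩, hW, hV, hi, hs, hq⟩
    refine ⟨?_, ⟨?_, ?_, ?_, ?_⟩, ?_, ?_, ?_, ?_, ?_⟩
    iterate 7
      simp [evalBody, Prog.sem, RExp.eval, NExp.eval, *]
    · intro i hik
      rcases Nat.lt_succ_iff_lt_or_eq.1 hik with h' | rfl
      · obtain ⟨ha, hb, hc⟩ := hi i h'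
        have hne : i ≠ k := h'.ne
        have hne2 : i ≠ k + N := by omega
        have hne3 : i + N ≠ k := by omega
        simp [evalBody, Prog.sem, RExp.eval, NExp.eval, hW, hN, hk, hne,
          hne2, hne3, ha, hb, hc]
      · have hne : N ≠ 0 := by omega
        simp [evalBody, Prog.sem, RExp.eval, NExp.eval, hW, hN, hk, hV,
          hB, hS, hne]
    all_goals
      simp [evalBody, Prog.sem, RExp.eval, NExp.eval,
        Finset.sum_range_succ, *]

theorem runs_search (h0 : σ.nat 0 = N) (h1 : σ.nat 1 = 0) (h2 : σ.nat 2 = 0) (h3 : σ.nat 3 = 0)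
    (hN : 0 < N) (hpos : ∃ k < N + N, 0 < σ.arr 4 k) :
    Runs (.loop (.ltN iV (.add nV nV)) searchBody) σ ((N + N + 1) * 100) fun τ =>
      τ.nat 0 = N ∧ τ.arr = σ.arr ∧
      (τ.nat 2 < N + N ∧ ∀ k < N + N, σ.arr 6 (τ.nat 2) ≤ σ.arr 6 k) ∧
      τ.nat 3 < N + N ∧ 0 < σ.arr 4 (τ.nat 3) ∧
        ∀ k < N + N, 0 < σ.arr 4 k → σ.arr 6 k ≤ σ.arr 6 (τ.nat 3) := by
  refine (Runs.forLoop (fun m τ => τ.nat 1 = m ∧ τ.nat 0 = N ∧ τ.arr = σ.arr ∧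
      (τ.nat 2 < N + N ∧ ∀ k < m, σ.arr 6 (τ.nat 2) ≤ σ.arr 6 k) ∧
      τ.nat 3 < N + N ∧
        ∀ k < m, 0 < σ.arr 4 k → 0 < σ.arr 4 (τ.nat 3) ∧ σ.arr 6 k ≤ σ.arr 6 (τ.nat 3))
    (N + N) 100 (by simp [searchBody, Prog.LoopFree]) (by decide) ?_ ?_ ?_).mono le_rfl ?_
  · rintro k τ ⟨hk, hB, -⟩
    exact ⟨hk, by simp [NExp.eval, hB]⟩
  · exact ⟨h1, h0, rfl, ⟨h2 ▸ Nat.add_pos_left hN N, by simp⟩, h3 ▸ Nat.add_pos_left hN N, by simp⟩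
  · rintro m hm τ ⟨hk, hB, ha, ⟨hp, hpmin⟩, hv, hvmax⟩
    have hp' : ∀ τ' : Mem, τ' = Prog.sem (.branch (.ltR (.cell 6 iV) (.cell 6 pV))
        (.setN 2 iV) .skip) τ → τ'.nat 0 = N ∧ τ'.nat 1 = m ∧ τ'.nat 3 = τ.nat 3 ∧
        τ'.arr = σ.arr ∧ τ'.nat 2 < N + N ∧ ∀ k < m + 1, σ.arr 6 (τ'.nat 2) ≤ σ.arr 6 k := by
      rintro _ rfl
      simp only [Prog.sem, BExp.holds, RExp.eval, NExp.eval, hk, ha]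
      split_ifs with hc
      · refine ⟨by simp [hB], by simp [hk], by simp, by simp [ha], by simpa using hm, ?_⟩
        intro k hkm
        rcases Nat.lt_succ_iff_lt_or_eq.1 hkm with h' | rfl
        · simpa using hc.le.trans (hpmin k h')
        · simp
      · refine ⟨hB, hk, rfl, ha, hp, ?_⟩
        intro k hkm
        rcases Nat.lt_succ_iff_lt_or_eq.1 hkm with h' | rfl
        · exact hpmin k h'
        · exact not_lt.1 hc
    simp only [searchBody]
    rw [Prog.sem]
    generalize hτ' : Prog.sem (.branch (.ltR (.cell 6 iV) (.cell 6 pV)) (.setN 2 iV) .skip) τ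
      = τ'
    obtain ⟨hB', hk', h3', ha', hp2, hpm⟩ := hp' τ' hτ'.symm
    simp only [Prog.sem, BExp.holds, RExp.eval, NExp.eval, hk', ha', h3', Rat.cast_zero]
    split_ifs with hc
    · refine ⟨by simp [hk'], by simp [hB'], by simp [ha'], ⟨by simpa using hp2, ?_⟩,
        by simpa using hm, ?_⟩
      · simpa using hpm
      · intro k hkm hk0
        rcases Nat.lt_succ_iff_lt_or_eq.1 hkm with h' | rfl
        · obtain ⟨h4, h5⟩ := hvmax k h' hk0
          refine ⟨by simpa using hc.1, ?_⟩
          by_contra hlt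
          refine hc.2 ⟨h4, fun h6 => hlt ?_⟩
          simpa using h5.trans h6.le
        · simpa using hk0
    · refine ⟨by simp [hk'], by simp [hB'], by simp [ha'], ⟨by simpa using hp2, ?_⟩,
        by simpa [h3'] using hv, ?_⟩
      · simpa using hpm
      · intro k hkm hk0
        rcases Nat.lt_succ_iff_lt_or_eq.1 hkm with h' | rfl
        · simpa [h3'] using hvmax k h' hk0
        · have h7 : 0 < σ.arr 4 (τ.nat 3) ∧ ¬ σ.arr 6 (τ.nat 3) < σ.arr 6 k := by
            by_contra h8
            exact hc ⟨hk0, h8⟩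
          simpa [h3'] using h7
  · rintro τ ⟨-, hB, ha, hp, hv, hvm⟩
    obtain ⟨k, hk, hk0⟩ := hpos
    exact ⟨hB, ha, hp, hv, (hvm k hk hk0).1, fun k hk hk0 => (hvm k hk hk0).2⟩

/-- The result of `scan`. -/
structure Scanned (N : ℕ) (M B S W V : ℕ → ℝ) (τ : Mem) : Prop where
  base : Base N M B S τ
  arr4 : τ.arr 4 = W
  arr5 : τ.arr 5 = V
  arr3 : ∀ i < N, τ.arr 3 i = S 0 * (W i - W (i + N))
  arr6 : ∀ i < N, τ.arr 6 i = S 0 * (V i + B i)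
  arr6' : ∀ i < N, τ.arr 6 (i + N) = -(S 0 * (V i + B i))
  reg0 : τ.arr 7 0 = ∑ i ∈ Finset.range N, (V i + B i) * (S 0 * (W i - W (i + N)))
  reg1 : τ.arr 7 1 = ∑ i ∈ Finset.range N, V i * (S 0 * (W i - W (i + N)))
  fw_lt : τ.nat 2 < N + N
  fw_le : ∀ k < N + N, τ.arr 6 (τ.nat 2) ≤ τ.arr 6 k
  away_lt : τ.nat 3 < N + N
  away_pos : 0 < W (τ.nat 3)
  away_le : ∀ k < N + N, 0 < W k → τ.arr 6 k ≤ τ.arr 6 (τ.nat 3)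

theorem runs_scan (h : Base N M B S σ) (hW : σ.arr 4 = W) (hV : σ.arr 5 = V)
    (hN : 0 < N) (hpos : ∃ k < N + N, 0 < W k) :
    Runs scan σ (500 * (N + 1)) (Scanned N M B S W V) := by
  have hinit : Runs (.seq (.setR 7 (.const 0) (.const 0)) (.seq (.setR 7 (.const 1) (.const 0))
      (.setN 1 (.const 0)))) σ 20 fun τ => Base N M B S τ ∧ τ.arr 4 = W ∧ τ.arr 5 = V ∧
      τ.nat 1 = 0 ∧ τ.arr 7 0 = 0 ∧ τ.arr 7 1 = 0 := by
    refine Prog.LoopFree.runs (by simp [Prog.LoopFree]) ?_ (by decide)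
    obtain ⟨h0, h1, h2, h3⟩ := h
    refine ⟨⟨?_, ?_, ?_, ?_⟩, ?_⟩ <;>
      simp [Prog.sem, RExp.eval, NExp.eval, *]
  refine (hinit.seq fun τ ⟨hB, h4, h5, h1, h70, h71⟩ =>
    (runs_eval hB h4 h5 h1 h70 h71).seq fun υ ⟨hB, h4, h5, hi, h70, h71⟩ => ?_).mono
      (U := 500 * (N + 1)) (T := 20 + ((N + 1) * 100 + (20 + (N + N + 1) * 100))) (by omega)
      fun _ h => h
  have hmid : Runs (.seq (.setN 1 (.const 0)) (.seq (.setN 2 (.const 0)) (.setN 3 (.const 0)))) υ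
      20 fun τ => τ.nat 0 = N ∧ τ.arr = υ.arr ∧ τ.nat 1 = 0 ∧ τ.nat 2 = 0 ∧ τ.nat 3 = 0 := by
    refine Prog.LoopFree.runs (by simp [Prog.LoopFree]) ?_ (by decide)
    simp [Prog.sem, NExp.eval, hB.nat0]
  refine hmid.seq fun τ ⟨h0, harr, h1, h2, h3⟩ => ?_
  refine (runs_search h0 h1 h2 h3 hN (by rwa [harr, h4])).mono le_rfl ?_
  rintro τ' ⟨h0', harr', ⟨hp, hpm⟩, hv, hv0, hvm⟩
  rw [harr] at harr' hpm hv0 hvm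
  rw [h4] at hv0 hvm
  obtain ⟨hn, hM, hB', hS⟩ := hB
  exact
    { base := ⟨h0', by rw [harr', hM], by rw [harr', hB'], by rw [harr', hS]⟩
      arr4 := by rw [harr', h4]
      arr5 := by rw [harr', h5]
      arr3 := fun i hiN => by rw [harr', (hi i hiN).1]
      arr6 := fun i hiN => by rw [harr', (hi i hiN).2.1]
      arr6' := fun i hiN => by rw [harr', (hi i hiN).2.2]
      reg0 := by rw [harr', h70]
      reg1 := by rw [harr', h71]
      fw_lt := hp
      fw_le := by rwa [harr']
      away_lt := hv
      away_pos := hv0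
      away_le := by rwa [harr'] }

/-- The step size that `lineSearch` computes from the curvature `q`, the directional gap `G` and
the maximal step size. -/
def stepSize (q G γmax : ℝ) : ℝ :=
  open Classical in if 0 < q ∧ G / q < γmax then G / q else γmax

theorem runs_choose (h : Base N M B S σ) (hW : σ.arr 4 = W) (hV : σ.arr 5 = V) :
    Runs choose σ 100 fun τ => Base N M B S τ ∧ τ.arr 4 = W ∧ τ.arr 5 = V ∧
      τ.arr 7 1 = σ.arr 7 1 ∧
      ((σ.arr 7 0 - σ.arr 6 (σ.nat 2) < σ.arr 6 (σ.nat 3) - σ.arr 7 0 ∧ τ.nat 4 = σ.nat 3 ∧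
        τ.arr 7 2 = -1 ∧ τ.arr 7 3 = σ.arr 6 (σ.nat 3) - σ.arr 7 0 ∧
        τ.arr 7 4 = W (σ.nat 3) / (1 - W (σ.nat 3))) ∨
      (σ.arr 6 (σ.nat 3) - σ.arr 7 0 ≤ σ.arr 7 0 - σ.arr 6 (σ.nat 2) ∧ τ.nat 4 = σ.nat 2 ∧
        τ.arr 7 2 = 1 ∧ τ.arr 7 3 = σ.arr 7 0 - σ.arr 6 (σ.nat 2) ∧ τ.arr 7 4 = 1)) := by
  refine Prog.LoopFree.runs (by simp [choose, Prog.LoopFree]) ?_ (by decide)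
  obtain ⟨h0, hM, hB, hS⟩ := h
  by_cases hc : σ.arr 7 0 - σ.arr 6 (σ.nat 2) < σ.arr 6 (σ.nat 3) - σ.arr 7 0
  · refine ⟨⟨?_, ?_, ?_, ?_⟩, ?_, ?_, ?_, Or.inl ⟨hc, ?_⟩⟩ <;>
      simp [choose, Prog.sem, BExp.holds, RExp.eval, NExp.eval, *]
  · refine ⟨⟨?_, ?_, ?_, ?_⟩, ?_, ?_, ?_, Or.inr ⟨not_lt.1 hc, ?_⟩⟩ <;>
      simp [choose, Prog.sem, BExp.holds, RExp.eval, NExp.eval, *]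

theorem runs_locate (h : Base N M B S σ) (hW : σ.arr 4 = W) (hV : σ.arr 5 = V) {i : ℕ} {s : Bool}
    (hi : i < N) (hk : σ.nat 4 = if s then i else i + N) :
    Runs locate σ 100 fun τ => Base N M B S τ ∧ τ.arr 4 = W ∧ τ.arr 5 = V ∧
      τ.arr 7 1 = σ.arr 7 1 ∧ τ.arr 7 2 = σ.arr 7 2 ∧ τ.arr 7 3 = σ.arr 7 3 ∧
      τ.arr 7 4 = σ.arr 7 4 ∧ τ.arr 7 5 = (if s then S 0 else -S 0) ∧ τ.nat 4 = σ.nat 4 ∧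
      τ.nat 5 = i ∧ τ.nat 6 = 0 ∧ τ.nat 1 = 0 := by
  refine Prog.LoopFree.runs (by simp [locate, Prog.LoopFree]) ?_ (by decide)
  obtain ⟨h0, hM, hB, hS⟩ := h
  cases s <;> refine ⟨⟨?_, ?_, ?_, ?_⟩, ?_⟩ <;>
    simp [locate, Prog.sem, BExp.holds, RExp.eval, NExp.eval, *] at hk ⊢

theorem runs_move (h : Base N M B S σ) (hW : σ.arr 4 = W) (hV : σ.arr 5 = V) {j k : ℕ} {q κ : ℝ}
    (hj : j < N) (h4 : σ.nat 4 = k) (h5 : σ.nat 5 = j) (h6 : σ.nat 6 = 0) (h1 : σ.nat 1 = 0)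
    (hq : q = σ.arr 7 5 * σ.arr 7 5 * M (j * N + j) - 2 * σ.arr 7 5 * V j + σ.arr 7 1)
    (hκ : κ = σ.arr 7 2 * stepSize q (σ.arr 7 3) (σ.arr 7 4)) (hk : k < N + N) :
    Runs move σ (700 * (N + 1)) fun τ => Base N M B S τ ∧
      (∀ i < N, τ.arr 5 i = (1 - κ) * V i + κ * (σ.arr 7 5 * M (j * N + i))) ∧
      ∀ i < N + N, τ.arr 4 i = (1 - κ) * W i + if i = k then κ else 0 := by
  have hoff : Runs (.loop (.ltN iV jV) offsetBody) σ ((j + 1) * 100) fun τ =>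
      Base N M B S τ ∧ τ.nat 6 = j * N ∧ τ.nat 4 = k ∧ τ.nat 5 = j ∧ τ.arr = σ.arr := by
    refine (Runs.forLoop (fun m τ => τ.nat 1 = m ∧ Base N M B S τ ∧ τ.nat 6 = m * N ∧
      τ.nat 4 = k ∧ τ.nat 5 = j ∧ τ.arr = σ.arr) j 100
      (by simp [offsetBody, Prog.LoopFree]) (by decide) ?_ ?_ ?_).mono le_rfl (fun τ h => h.2)
    · rintro m τ ⟨hm, -, -, -, h5, -⟩
      exact ⟨hm, h5⟩
    · exact ⟨h1, h, by simpa using h6, h4, h5, rfl⟩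
    · rintro m hm τ ⟨h1, ⟨hN, hM, hB, hS⟩, h6, h4, h5, ha⟩
      refine ⟨?_, ⟨?_, ?_, ?_, ?_⟩, ?_⟩
      iterate 5
        simp [offsetBody, Prog.sem, NExp.eval, *]
      simp only [offsetBody, Prog.sem, NExp.eval]
      simp [h6, hN, h4, h5, ha, add_one_mul]
  have hline : ∀ τ : Mem, (Base N M B S τ ∧ τ.nat 6 = j * N ∧ τ.nat 4 = k ∧ τ.nat 5 = j ∧
      τ.arr = σ.arr) → Runs lineSearch τ 100 fun υ => Base N M B S υ ∧ υ.nat 6 = j * N ∧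
        υ.nat 4 = k ∧ υ.nat 1 = 0 ∧ υ.arr 4 = W ∧ υ.arr 5 = V ∧ υ.arr 7 5 = σ.arr 7 5 ∧
        υ.arr 7 7 = κ := by
    rintro τ ⟨⟨hN, hM, hB, hS⟩, h6, h4, h5, ha⟩
    rw [ha] at hM hB hS
    refine Prog.LoopFree.runs (by simp [lineSearch, Prog.LoopFree]) ?_ (by decide)
    have hq' : σ.arr 7 5 * σ.arr 7 5 * M (j * N + j) - 2 * σ.arr 7 5 * V j + σ.arr 7 1 = q :=
      hq.symm
    by_cases hc : 0 < q ∧ σ.arr 7 3 / q < σ.arr 7 4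
    · rw [stepSize, if_pos hc] at hκ
      refine ⟨⟨?_, ?_, ?_, ?_⟩, ?_⟩ <;>
        simp [lineSearch, Prog.sem, BExp.holds, RExp.eval, NExp.eval,
          ha, hN, hM, hB, hS, hW, hV, h6, h4, h5, hq', hc, hκ]
    · rw [stepSize, if_neg hc] at hκ
      refine ⟨⟨?_, ?_, ?_, ?_⟩, ?_⟩ <;>
        simp [lineSearch, Prog.sem, BExp.holds, RExp.eval, NExp.eval,
          ha, hN, hM, hB, hS, hW, hV, h6, h4, h5, hq', hc, hκ]
  have himg : ∀ τ : Mem, (Base N M B S τ ∧ τ.nat 6 = j * N ∧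
        τ.nat 4 = k ∧ τ.nat 1 = 0 ∧ τ.arr 4 = W ∧ τ.arr 5 = V ∧ τ.arr 7 5 = σ.arr 7 5 ∧
        τ.arr 7 7 = κ) → Runs (.loop (.ltN iV nV) imageBody) τ ((N + 1) * 100) fun υ =>
      Base N M B S υ ∧ υ.nat 4 = k ∧ υ.arr 4 = W ∧ υ.arr 7 7 = κ ∧
      ∀ i < N, υ.arr 5 i = (1 - κ) * V i + κ * (σ.arr 7 5 * M (j * N + i)) := by
    rintro τ ⟨hB, h6, h4, h1, hW, hV, h75, h77⟩
    refine (Runs.forLoop (fun m υ => υ.nat 1 = m ∧ υ.nat 6 = j * N ∧ υ.arr 7 5 = σ.arr 7 5 ∧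
      (∀ i, m ≤ i → υ.arr 5 i = V i) ∧ Base N M B S υ ∧ υ.nat 4 = k ∧ υ.arr 4 = W ∧
      υ.arr 7 7 = κ ∧ ∀ i < m, υ.arr 5 i = (1 - κ) * V i + κ * (σ.arr 7 5 * M (j * N + i))) N 100
      (by simp [imageBody, Prog.LoopFree]) (by decide) ?_ ?_ ?_).mono le_rfl
        (fun υ h => h.2.2.2.2)
    · rintro m υ ⟨hm, -, -, -, hB, -⟩
      exact ⟨hm, hB.nat0⟩
    · exact ⟨h1, h6, h75, fun i _ => by rw [hV], hB, h4, hW, h77, by simp⟩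
    · rintro m hm υ ⟨h1, h6, h75, hge, ⟨hN, hM, hB, hS⟩, h4, hW, h77, hlt⟩
      have hne : ∀ i, m + 1 ≤ i → i ≠ m := fun i hi => by omega
      refine ⟨?_, ?_, ?_, ?_, ⟨?_, ?_, ?_, ?_⟩, ?_, ?_, ?_, ?_⟩
      iterate 3
        simp [imageBody, Prog.sem, RExp.eval, NExp.eval, *]
      · intro i hi
        have := hge i (by omega)
        simpa [imageBody, Prog.sem, RExp.eval, NExp.eval, Function.update_apply, h1, hne i hi]
      iterate 7
        simp [imageBody, Prog.sem, RExp.eval, NExp.eval, *]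
      · intro i hi
        rcases Nat.lt_succ_iff_lt_or_eq.1 hi with h' | rfl
        · simpa [imageBody, Prog.sem, RExp.eval, NExp.eval, Function.update_apply, h1, h'.ne]
            using hlt i h'
        · simp [imageBody, Prog.sem, RExp.eval, NExp.eval, h1, h6, hM,
            h75, h77, hge i le_rfl]
  have hwt : ∀ τ : Mem, τ.nat 1 = 0 → Base N M B S τ → τ.nat 4 = k → τ.arr 4 = W →
      τ.arr 7 7 = κ → Runs (.loop (.ltN iV (.add nV nV)) weightBody) τ ((N + N + 1) * 100)
        fun υ => Base N M B S υ ∧ υ.nat 4 = k ∧ υ.arr 5 = τ.arr 5 ∧ υ.arr 7 7 = κ ∧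
          ∀ i < N + N, υ.arr 4 i = (1 - κ) * W i := by
    intro τ h1 hB h4 hW h77
    refine (Runs.forLoop (fun m υ => υ.nat 1 = m ∧ (∀ i, m ≤ i → υ.arr 4 i = W i) ∧
      Base N M B S υ ∧ υ.nat 4 = k ∧ υ.arr 5 = τ.arr 5 ∧ υ.arr 7 7 = κ ∧
      ∀ i < m, υ.arr 4 i = (1 - κ) * W i) (N + N) 100
      (by simp [weightBody, Prog.LoopFree]) (by decide) ?_ ?_ ?_).mono le_rfl (fun υ h => h.2.2)
    · rintro m υ ⟨hm, -, hB, -⟩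
      exact ⟨hm, by simp [NExp.eval, hB.nat0]⟩
    · exact ⟨h1, fun i _ => by rw [hW], hB, h4, rfl, h77, by simp⟩
    · rintro m hm υ ⟨h1, hge, ⟨hN, hM, hB, hS⟩, h4, h5, h77, hlt⟩
      have hne : ∀ i, m + 1 ≤ i → i ≠ m := fun i hi => by omega
      refine ⟨?_, ?_, ⟨?_, ?_, ?_, ?_⟩, ?_, ?_, ?_, ?_⟩
      · simp [weightBody, Prog.sem, RExp.eval, NExp.eval, *]
      · intro i hi
        have := hge i (by omega)
        simpa [weightBody, Prog.sem, RExp.eval, NExp.eval, Function.update_apply, h1, hne i hi]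
      iterate 7
        simp [weightBody, Prog.sem, RExp.eval, NExp.eval, *]
      · intro i hi
        rcases Nat.lt_succ_iff_lt_or_eq.1 hi with h' | rfl
        · simpa [weightBody, Prog.sem, RExp.eval, NExp.eval, Function.update_apply, h1, h'.ne]
            using hlt i h'
        · simp [weightBody, Prog.sem, RExp.eval, NExp.eval, h1, h77,
            hge i le_rfl]
  refine (hoff.seq fun τ hτ => (hline τ hτ).seq fun υ hυ => (himg υ hυ).seq
    fun τ₁ ⟨hB₁, h4₁, hW₁, h77₁, h5₁⟩ => Runs.seq (T := 10) (P := fun τ₂ => τ₂ = τ₁.setN 1 0)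
      (Prog.LoopFree.runs (by simp [Prog.LoopFree]) rfl (by decide)) ?_).mono
    (T := (j + 1) * 100 + (100 + ((N + 1) * 100 + (10 + ((N + N + 1) * 100 + 20)))))
    (by omega) fun _ h => h
  rintro _ rfl
  obtain ⟨hN, hM, hB, hS⟩ := hB₁
  refine (hwt (τ₁.setN 1 0) (by simp) ⟨by simpa using hN, hM, hB, hS⟩ (by simpa using h4₁) hW₁
    h77₁).seq fun υ' ⟨hB', h4', h5', h77', hlt⟩ => ?_
  refine Prog.LoopFree.runs (by simp [Prog.LoopFree]) ?_ (by decide)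
  obtain ⟨hN, hM, hB, hS⟩ := hB'
  refine ⟨⟨?_, ?_, ?_, ?_⟩, ?_, ?_⟩
  iterate 4
    simp [Prog.sem, RExp.eval, NExp.eval, *]
  · intro i hi
    simpa [Prog.sem, RExp.eval, NExp.eval, h5'] using h5₁ i hi
  · intro i hi
    by_cases hik : i = k
    · subst hik
      simp [Prog.sem, RExp.eval, NExp.eval, h4', hlt i hi, h77']
    · simpa [Prog.sem, RExp.eval, NExp.eval, Function.update_apply, h4', hik] using hlt i hi

theorem runs_start (h : Base N M B S σ) (h4 : σ.arr 4 = 0) (h1 : σ.nat 1 = 0) :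
    Runs start σ (100 * (N + 2)) fun τ => Base N M B S τ ∧ τ.arr 4 = Pi.single 0 1 ∧
      ∀ i < N, τ.arr 5 i = S 0 * M i := by
  have hset : Runs (.setR 4 (.const 0) (.const 1)) σ 100 fun τ => Base N M B S τ ∧
      τ.arr 4 = Pi.single 0 1 ∧ τ.nat 1 = 0 := by
    refine Prog.LoopFree.runs (by simp [Prog.LoopFree]) ?_ (by decide)
    obtain ⟨hN, hM, hB, hS⟩ := h
    refine ⟨⟨?_, ?_, ?_, ?_⟩, ?_, ?_⟩ <;>
      simp [Prog.sem, RExp.eval, NExp.eval, Pi.single, *]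
  refine (hset.seq (U := (N + 1) * 100) fun τ ⟨hB, h4, h1⟩ => ?_).mono (by omega) fun _ h => h
  refine (Runs.forLoop (fun m υ => υ.nat 1 = m ∧ Base N M B S υ ∧ υ.arr 4 = Pi.single 0 1 ∧
      ∀ i < m, υ.arr 5 i = S 0 * M i) N 100
      (by simp [Prog.LoopFree]) (by decide) ?_ ?_ ?_).mono le_rfl (fun υ h => h.2)
  · rintro m υ ⟨hm, hB, -⟩
    exact ⟨hm, hB.nat0⟩
  · exact ⟨h1, hB, h4, by simp⟩
  · rintro m hm υ ⟨h1, ⟨hN, hM, hB, hS⟩, h4, hlt⟩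
    refine ⟨?_, ⟨?_, ?_, ?_, ?_⟩, ?_, ?_⟩
    iterate 6
      simp [Prog.sem, RExp.eval, NExp.eval, *]
    intro i hi
    rcases Nat.lt_succ_iff_lt_or_eq.1 hi with h' | rfl
    · simpa [Prog.sem, RExp.eval, NExp.eval, Function.update_apply, h1, h'.ne] using hlt i h'
    · simp [Prog.sem, RExp.eval, NExp.eval, h1, hM, hS]

end AFWProg

end RealRAM

namespace L1Problem

open Matrix

/-! ### Quadratic objectives -/

variable {n : ℕ} {A : Matrix (Fin n) (Fin n) ℝ} {b : Fin n → ℝ} {R : ℝ}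

theorem inner_eq_dotProduct (x y : EuclideanSpace ℝ (Fin n)) :
    inner ℝ x y = x.ofLp ⬝ᵥ y.ofLp := inner_eq_sum x y

theorem dotProduct_mulVec_comm (hA : A.PosSemidef) (x y : Fin n → ℝ) :
    x ⬝ᵥ A.mulVec y = y ⬝ᵥ A.mulVec x := by
  have hT : Aᵀ = A := by simpa [Matrix.IsHermitian] using hA.1
  rw [dotProduct_mulVec, ← mulVec_transpose, hT, dotProduct_comm]

theorem quadObj_add_smul (hA : A.PosSemidef) (x d : EuclideanSpace ℝ (Fin n)) (γ : ℝ) :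
    quadObj A b (x + γ • d) = quadObj A b x +
      γ * inner ℝ (WithLp.toLp 2 (A.mulVec x.ofLp + b)) d +
      γ ^ 2 / 2 * (d.ofLp ⬝ᵥ A.mulVec d.ofLp) := by
  have h := dotProduct_mulVec_comm hA x.ofLp d.ofLp
  rw [inner_eq_dotProduct]
  simp only [quadObj, WithLp.ofLp_add, WithLp.ofLp_smul, mulVec_add, mulVec_smul, add_dotProduct,
    dotProduct_add, smul_dotProduct, dotProduct_smul, smul_eq_mul, h]
  rw [dotProduct_comm (A.mulVec x.ofLp) d.ofLp]
  ring

theorem hasGradientAt_quadObj (hA : A.PosSemidef) (x : EuclideanSpace ℝ (Fin n)) :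
    HasGradientAt (quadObj A b) (WithLp.toLp 2 (A.mulVec x.ofLp + b)) x := by
  set T := toEuclideanCLM (𝕜 := ℝ) (n := Fin n) A with hT
  have hTx : ∀ y, (T y).ofLp = A.mulVec y.ofLp := fun y => rfl
  have hf : quadObj A b = fun y => (1 / 2 : ℝ) * inner ℝ y (T y) + inner ℝ (WithLp.toLp 2 b) y := by
    ext y
    rw [inner_eq_dotProduct, inner_eq_dotProduct, hTx]
    rfl
  have h1 : HasFDerivAt (fun y : EuclideanSpace ℝ (Fin n) => inner ℝ y (T y)) _ x :=
    (hasFDerivAt_id x).inner ℝ T.hasFDerivAt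
  have h2 : HasFDerivAt (fun y : EuclideanSpace ℝ (Fin n) => inner ℝ (WithLp.toLp 2 b) y) _ x :=
    (hasFDerivAt_const (WithLp.toLp 2 b) x).inner ℝ (hasFDerivAt_id x)
  rw [hf, hasGradientAt_iff_hasFDerivAt]
  refine ((h1.const_mul (1 / 2)).add h2).congr_fderiv ?_
  ext v
  have h := dotProduct_mulVec_comm hA x.ofLp v.ofLp
  simp only [_root_.add_apply, _root_.smul_apply,
    ContinuousLinearMap.comp_apply, ContinuousLinearMap.prod_apply, fderivInnerCLM_apply,
    ContinuousLinearMap.id_apply, _root_.zero_apply, inner_zero_left, add_zero,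
    InnerProductSpace.toDual_apply_apply, id, smul_eq_mul, inner_eq_dotProduct, hTx, h,
    add_dotProduct]
  rw [dotProduct_comm (A.mulVec x.ofLp) v.ofLp]
  ring

theorem gradient_quadObj (hA : A.PosSemidef) (x : EuclideanSpace ℝ (Fin n)) :
    gradient (quadObj A b) x = WithLp.toLp 2 (A.mulVec x.ofLp + b) :=
  (hasGradientAt_quadObj hA x).gradient

theorem dotProduct_mulVec_self_nonneg (hA : A.PosSemidef) (d : Fin n → ℝ) :
    0 ≤ d ⬝ᵥ A.mulVec d := by
  simpa using hA.dotProduct_mulVec_nonneg d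

theorem convexOn_quadObj (hA : A.PosSemidef) : ConvexOn ℝ (l1Ball n R) (quadObj A b) := by
  refine ⟨convex_l1Ball R, fun x _ y _ c e hc he hce => ?_⟩
  set z := c • x + e • y with hz
  -- compare both values with the tangent at the convex combination
  have key : ∀ u, quadObj A b z + inner ℝ (WithLp.toLp 2 (A.mulVec z.ofLp + b)) (u - z) ≤
      quadObj A b u := by
    intro u
    have h := quadObj_add_smul (b := b) hA z (u - z) 1
    rw [one_smul, add_sub_cancel] at h
    have h2 := dotProduct_mulVec_self_nonneg hA (u - z).ofLp
    linarith
  have h1 := mul_le_mul_of_nonneg_left (key x) hc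
  have h2 := mul_le_mul_of_nonneg_left (key y) he
  have h3 : c * inner ℝ (WithLp.toLp 2 (A.mulVec z.ofLp + b)) (x - z) +
      e * inner ℝ (WithLp.toLp 2 (A.mulVec z.ofLp + b)) (y - z) = 0 := by
    rw [← real_inner_smul_right, ← real_inner_smul_right, ← inner_add_right]
    have : c • (x - z) + e • (y - z) = 0 := by
      rw [smul_sub, smul_sub, sub_add_sub_comm, ← hz, ← add_smul, hce, one_smul, sub_self]
    rw [this, inner_zero_right]
  have h4 : quadObj A b z = c * quadObj A b z + e * quadObj A b z := by
    rw [← add_mul, hce, one_mul]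
  simp only [smul_eq_mul]
  linarith

/-- Exact line search for a quadratic in closed form. -/
theorem isLineSearch_stepSize (hA : A.PosSemidef) {x d : EuclideanSpace ℝ (Fin n)} {γmax q G : ℝ}
    (hq : q = d.ofLp ⬝ᵥ A.mulVec d.ofLp) (hG : G = inner ℝ (-gradient (quadObj A b) x) d)
    (hG0 : 0 ≤ G) (hγ : 0 ≤ γmax) :
    AFW.IsLineSearch (quadObj A b) x d γmax (RealRAM.AFWProg.stepSize q G γmax) := by
  have hq0 : 0 ≤ q := hq ▸ dotProduct_mulVec_self_nonneg hA d.ofLp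
  have hval : ∀ η : ℝ, quadObj A b (x + η • d) = quadObj A b x - η * G + η ^ 2 / 2 * q := by
    intro η
    rw [quadObj_add_smul hA, hG, hq, gradient_quadObj hA, inner_neg_left]
    ring
  unfold RealRAM.AFWProg.stepSize
  split_ifs with hc
  · refine ⟨⟨by have := hc.1; positivity, hc.2.le⟩, fun η _ => ?_⟩
    rw [hval, hval]
    have h1 : 0 ≤ q / 2 * (η - G / q) ^ 2 := by have := hc.1; positivity
    have h2 : q / 2 * (η - G / q) ^ 2 =
        -η * G + η ^ 2 / 2 * q - (-(G / q) * G + (G / q) ^ 2 / 2 * q) := by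
      have := hc.1.ne'
      field_simp
      ring
    linarith
  · refine ⟨⟨hγ, le_rfl⟩, fun η hη => ?_⟩
    rw [hval, hval]
    have h1 : q * γmax ≤ G := by
      rcases hq0.eq_or_lt with h0 | h0
      · rw [← h0, zero_mul]
        exact hG0
      · have h2 : γmax ≤ G / q := not_lt.1 fun h => hc ⟨h0, h⟩
        rw [le_div_iff₀ h0] at h2
        linarith
    have h3 := mul_le_mul_of_nonneg_left hη.2 hq0
    have h4 : 0 ≤ (γmax - η) * (G - q * (η + γmax) / 2) :=
      mul_nonneg (sub_nonneg.2 hη.2) (by linarith)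
    nlinarith

end L1Problem

namespace RealRAM.AFWProg

open L1Problem AFW Matrix

/-! ### Correctness of the program -/

/-- The number of an atom in the arrays of the program. -/
def code {n : ℕ} (a : Atom n) : ℕ := if a.2 then a.1 else a.1 + n

/-- The vector of weights stored in a memory. -/
def weightsOf (n : ℕ) (σ : Mem) (a : Atom n) : ℝ := σ.arr 4 (code a)

variable {n : ℕ} {A : Matrix (Fin n) (Fin n) ℝ} {b : Fin n → ℝ} {R ε : ℝ} {σ : Mem}

theorem code_lt (a : Atom n) : code a < n + n := by
  have := a.1.isLt
  unfold code
  split_ifs <;> omega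

theorem code_injective : Function.Injective (code (n := n)) := by
  rintro ⟨i, s⟩ ⟨j, t⟩ h
  have hi := i.isLt
  have hj := j.isLt
  cases s <;> cases t <;> simp only [code, if_true, Bool.false_eq_true, if_false] at h <;>
    simp [Fin.ext_iff] <;> omega

theorem exists_code_eq {k : ℕ} (hk : k < n + n) : ∃ a : Atom n, code a = k := by
  by_cases h : k < n
  · exact ⟨(⟨k, h⟩, true), by simp [code]⟩
  · refine ⟨(⟨k - n, by omega⟩, false), ?_⟩
    simp only [code, Bool.false_eq_true, if_false]
    omega

theorem inputMem_matrix (i j : Fin n) : (inputMem A b R ε).arr 0 (i * n + j) = A i j := by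
  have hk : (i * n + j : ℕ) = (finProdFinEquiv (i, j) : Fin (n * n)) := by
    simp [finProdFinEquiv, mul_comm, add_comm]
  rw [hk]
  simp only [inputMem, Fin.is_lt, dif_pos, Fin.eta, Equiv.symm_apply_apply]

theorem inputMem_vector (i : Fin n) : (inputMem A b R ε).arr 1 i = b i := by
  simp [inputMem]

/-- The curvature of a quadratic along the line from `x` to an atom. -/
theorem curvature_vertex (hA : A.PosSemidef) (a : Atom n) (x : EuclideanSpace ℝ (Fin n)) :
    (vertex R a - x).ofLp ⬝ᵥ A.mulVec (vertex R a - x).ofLp =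
      (if a.2 then R else -R) * (if a.2 then R else -R) * A a.1 a.1 -
        2 * (if a.2 then R else -R) * A.mulVec x.ofLp a.1 + x.ofLp ⬝ᵥ A.mulVec x.ofLp := by
  have h := dotProduct_mulVec_comm hA x.ofLp (vertex R a).ofLp
  simp only [WithLp.ofLp_sub, mulVec_sub, sub_dotProduct, dotProduct_sub, h]
  simp only [vertex, PiLp.ofLp_single, single_dotProduct, mulVec_single, Pi.smul_apply,
    MulOpposite.smul_eq_mul_unop, MulOpposite.unop_op, col_apply]
  ring

theorem mulVec_vertex (a : Atom n) (i : Fin n) :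
    A.mulVec (vertex R a).ofLp i = (if a.2 then R else -R) * A i a.1 := by
  simp only [vertex, PiLp.ofLp_single, mulVec_single, Pi.smul_apply,
    MulOpposite.smul_eq_mul_unop, MulOpposite.unop_op, col_apply]
  ring

variable (A b R ε) in
/-- The invariant of the main loop: the memory stores a convex combination `x` of atoms, the
vector `A x`, and the results of `scan`. -/
structure Rep (σ : Mem) : Prop where
  scanned : Scanned n ((inputMem A b R ε).arr 0) ((inputMem A b R ε).arr 1)
    ((inputMem A b R ε).arr 2) (σ.arr 4) (σ.arr 5) σ
  weights : IsWeights (weightsOf n σ)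
  image : ∀ i : Fin n, σ.arr 5 i = A.mulVec (point R (weightsOf n σ)).ofLp i

theorem coord_eq (σ : Mem) (i : Fin n) :
    (inputMem A b R ε).arr 2 0 * (σ.arr 4 i - σ.arr 4 (i + n)) =
      point R (weightsOf n σ) i := by
  rw [point_apply]
  simp [inputMem, weightsOf, code]

theorem Rep.iterate (h : Rep A b R ε σ) (i : Fin n) :
    σ.arr 3 i = point R (weightsOf n σ) i := by
  rw [h.scanned.arr3 i i.isLt, coord_eq]

theorem Rep.output (h : Rep A b R ε σ) : output n σ = point R (weightsOf n σ) := by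
  ext i
  exact h.iterate i

theorem Rep.value_atom (h : Rep A b R ε σ) (hA : A.PosSemidef) (a : Atom n) :
    σ.arr 6 (code a) =
      inner ℝ (gradient (quadObj A b) (point R (weightsOf n σ))) (vertex R a) := by
  rw [inner_vertex, gradient_quadObj hA]
  have h1 := h.scanned.arr6 a.1 a.1.isLt
  have h2 := h.scanned.arr6' a.1 a.1.isLt
  rw [h.image, inputMem_vector] at h1 h2
  obtain ⟨i, s⟩ := a
  cases s
  · simpa [code, inputMem] using h2
  · simpa [code, inputMem] using h1

theorem Rep.value_iterate (h : Rep A b R ε σ) (hA : A.PosSemidef) :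
    σ.arr 7 0 = inner ℝ (gradient (quadObj A b) (point R (weightsOf n σ)))
      (point R (weightsOf n σ)) := by
  rw [gradient_quadObj hA, inner_eq_sum, h.scanned.reg0, ← Fin.sum_univ_eq_sum_range]
  refine Finset.sum_congr rfl fun i _ => ?_
  rw [coord_eq, h.image, inputMem_vector]
  rfl

theorem Rep.quadratic_iterate (h : Rep A b R ε σ) :
    σ.arr 7 1 = (point R (weightsOf n σ)).ofLp ⬝ᵥ
      A.mulVec (point R (weightsOf n σ)).ofLp := by
  rw [h.scanned.reg1, ← Fin.sum_univ_eq_sum_range]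
  refine Finset.sum_congr rfl fun i _ => ?_
  rw [coord_eq, h.image, mul_comm]

theorem Rep.fwAtom (h : Rep A b R ε σ) (hA : A.PosSemidef) : ∃ p : Atom n, code p = σ.nat 2 ∧
    IsFWAtom R (gradient (quadObj A b) (point R (weightsOf n σ))) p := by
  obtain ⟨p, hp⟩ := exists_code_eq h.scanned.fw_lt
  refine ⟨p, hp, fun c => ?_⟩
  rw [← h.value_atom hA, ← h.value_atom hA, hp]
  exact h.scanned.fw_le _ (code_lt c)

theorem Rep.awayAtom (h : Rep A b R ε σ) (hA : A.PosSemidef) : ∃ v : Atom n, code v = σ.nat 3 ∧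
    IsAwayAtom R (weightsOf n σ)
      (gradient (quadObj A b) (point R (weightsOf n σ))) v := by
  obtain ⟨v, hv⟩ := exists_code_eq h.scanned.away_lt
  refine ⟨v, hv, ?_, fun c hc => ?_⟩
  · unfold weightsOf
    rw [hv]
    exact h.scanned.away_pos
  · rw [← h.value_atom hA, ← h.value_atom hA, hv]
    exact h.scanned.away_le _ (code_lt c) hc

theorem Rep.test_iff (h : Rep A b R ε σ) (hA : A.PosSemidef) :
    test.holds σ ↔ ¬ GapAtMost (quadObj A b) R ε (point R (weightsOf n σ)) := by
  obtain ⟨p, hp, hpmin⟩ := h.fwAtom hA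
  have hε : σ.arr 2 1 = ε := by
    rw [h.scanned.base.arr2]
    simp [inputMem]
  simp only [test, BExp.holds, RExp.eval, NExp.eval, hε, ← hp, h.value_atom hA,
    h.value_iterate hA, GapAtMost, not_forall, not_le, inner_neg_left, inner_sub_right]
  constructor
  · intro hlt
    exact ⟨p, by linarith⟩
  · rintro ⟨a, ha⟩
    linarith [hpmin a]

theorem runs_scan_rep (hn : 0 < n) {x : EuclideanSpace ℝ (Fin n)}
    (hbase : Base n ((inputMem A b R ε).arr 0) ((inputMem A b R ε).arr 1)
      ((inputMem A b R ε).arr 2) σ) (hw : IsWeights (weightsOf n σ))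
    (hx : point R (weightsOf n σ) = x) (himg : ∀ i : Fin n, σ.arr 5 i = A.mulVec x.ofLp i) :
    Runs scan σ (500 * (n + 1)) fun τ => Rep A b R ε τ ∧ weightsOf n τ = weightsOf n σ := by
  obtain ⟨a, ha⟩ := hw.exists_pos
  refine (runs_scan hbase rfl rfl hn ⟨code a, code_lt a, ha⟩).mono le_rfl fun τ hτ => ?_
  have hwτ : weightsOf n τ = weightsOf n σ := by
    ext a
    simp only [weightsOf, hτ.arr4]
  refine ⟨⟨?_, by rwa [hwτ], ?_⟩, hwτ⟩
  · rwa [hτ.arr4, hτ.arr5]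
  · rw [hτ.arr5, hwτ, hx]
    exact himg

/-- The last three parts of an iteration, for a step with signed step size `κ` in the direction
of the chosen atom `a`. -/
theorem runs_locate_move_scan (hA : A.PosSemidef) (hn : 0 < n)
    {V W : ℕ → ℝ} {w : Atom n → ℝ} {a : Atom n} {q κ : ℝ}
    (hbase : Base n ((inputMem A b R ε).arr 0) ((inputMem A b R ε).arr 1)
      ((inputMem A b R ε).arr 2) σ) (hW : σ.arr 4 = W) (hV : σ.arr 5 = V)
    (hwW : ∀ c, w c = W (code c)) (himg : ∀ i : Fin n, V i = A.mulVec (point R w).ofLp i)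
    (h71 : σ.arr 7 1 = (point R w).ofLp ⬝ᵥ A.mulVec (point R w).ofLp)
    (hk : σ.nat 4 = code a)
    (hq : q = (vertex R a - point R w).ofLp ⬝ᵥ A.mulVec (vertex R a - point R w).ofLp)
    (hκ : κ = σ.arr 7 2 * stepSize q (σ.arr 7 3) (σ.arr 7 4))
    (hw' : IsWeights fun c => (1 - κ) * w c + if c = a then κ else 0) :
    Runs (.seq locate (.seq move scan)) σ (1300 * (n + 1)) fun τ => Rep A b R ε τ ∧
      weightsOf n τ = fun c => (1 - κ) * w c + if c = a then κ else 0 := by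
  have hsym : ∀ i j, A i j = A j i := fun i j => by
    have h := hA.1.apply j i
    simpa using h
  refine ((runs_locate hbase hW hV a.1.isLt (s := a.2) hk).seq (U := 1200 * (n + 1))
    fun τ ⟨hB, h4, h5, h71', h72, h73, h74, h75, hk', hj, ho, hi⟩ => ?_).mono (by omega)
      fun _ h => h
  have hS : (inputMem A b R ε).arr 2 0 = R := by simp [inputMem]
  rw [hS] at h75
  have hq' : q = τ.arr 7 5 * τ.arr 7 5 * (inputMem A b R ε).arr 0 (a.1 * n + a.1) -
      2 * τ.arr 7 5 * V a.1 + τ.arr 7 1 := by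
    rw [hq, curvature_vertex hA, h75, inputMem_matrix, himg, h71', h71]
  refine ((runs_move hB h4 h5 a.1.isLt (hk'.trans hk) hj ho hi hq' (κ := κ)
    (by rw [hκ, h72, h73, h74]) (code_lt a)).seq (U := 500 * (n + 1))
    fun υ ⟨hB', himg', hwt⟩ => ?_).mono (by omega) fun _ h => h
  have hwυ : weightsOf n υ = fun c => (1 - κ) * w c + if c = a then κ else 0 := by
    ext c
    simp only [weightsOf, hwt _ (code_lt c), hwW, code_injective.eq_iff]
  refine (runs_scan_rep hn hB' (hwυ ▸ hw') (x := (1 - κ) • point R w + κ • vertex R a)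
    (by rw [hwυ, point_add_single]) fun i => ?_).mono le_rfl
      fun _ h => ⟨h.1, h.2.trans hwυ⟩
  rw [himg' i i.isLt, himg, h75, inputMem_matrix, hsym a.1 i]
  simp only [WithLp.ofLp_add, WithLp.ofLp_smul, mulVec_add, mulVec_smul, Pi.add_apply,
    Pi.smul_apply, smul_eq_mul, mulVec_vertex]

/-- The body of the main loop performs one iteration of the algorithm. -/
theorem Rep.runs_iteration (hA : A.PosSemidef) (hR : 0 < R) (hn : 0 < n) (h : Rep A b R ε σ) :
    Runs iteration σ (1400 * (n + 1)) fun τ => Rep A b R ε τ ∧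
      Step (quadObj A b) R (weightsOf n σ) (weightsOf n τ) := by
  obtain ⟨p, hp, hpmin⟩ := h.fwAtom hA
  obtain ⟨v, hv, hvmax⟩ := h.awayAtom hA
  have h70 := h.value_iterate hA
  have h71 := h.quadratic_iterate
  have h6p := h.value_atom hA p
  have h6v := h.value_atom hA v
  have himg := h.image
  have hw := h.weights
  have hx := point_mem hR.le hw
  rw [hp] at h6p
  rw [hv] at h6v
  set w := weightsOf n σ with hwdef
  set g := gradient (quadObj A b) (point R w) with hg
  have hFW : inner ℝ (-g) (vertex R p - point R w) = σ.arr 7 0 - σ.arr 6 (σ.nat 2) := by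
    rw [h70, h6p, inner_neg_left, inner_sub_right]
    ring
  have hAway : inner ℝ (-g) (point R w - vertex R v) = σ.arr 6 (σ.nat 3) - σ.arr 7 0 := by
    rw [h70, h6v, inner_neg_left, inner_sub_right]
    ring
  have hFW0 : 0 ≤ inner ℝ (-g) (vertex R p - point R w) := by
    have := inner_vertex_le_of_mem hR hpmin hx
    rw [inner_neg_left, inner_sub_right]
    linarith
  refine ((runs_choose h.scanned.base rfl rfl).seq (U := 1300 * (n + 1))
    fun τ ⟨hB, h4, h5, h71', hcase⟩ => ?_).mono (by omega) fun _ h => h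
  rw [h71] at h71'
  rcases hcase with ⟨hlt, hk, h72, h73, h74⟩ | ⟨hle, hk, h72, h73, h74⟩
  · -- an away step
    rw [← hFW, ← hAway] at hlt
    have hv1 := hw.lt_one_of_lt hR hpmin hlt
    have hγmax : τ.arr 7 4 = w v / (1 - w v) := by rw [h74, hwdef, weightsOf, hv]
    set q := (vertex R v - point R w).ofLp ⬝ᵥ A.mulVec (vertex R v - point R w).ofLp with hq
    have hq' : q = (point R w - vertex R v).ofLp ⬝ᵥ A.mulVec (point R w - vertex R v).ofLp := by
      rw [hq, ← neg_sub (point R w) (vertex R v), WithLp.ofLp_neg, mulVec_neg, neg_dotProduct,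
        dotProduct_neg, neg_neg]
    set γ := stepSize q (τ.arr 7 3) (τ.arr 7 4) with hγ
    have hls : IsLineSearch (quadObj A b) (point R w) (point R w - vertex R v)
        (w v / (1 - w v)) γ := by
      rw [hγ, hγmax]
      exact isLineSearch_stepSize hA hq' (by rw [h73, ← hAway]) (by rw [h73, ← hAway]; linarith)
        (div_nonneg hvmax.1.le (sub_pos.2 hv1).le)
    have heq : (fun c => (1 - -1 * γ) * w c + if c = v then -1 * γ else 0) =
        fun c => (1 + γ) * w c - if c = v then γ else 0 := by
      ext c
      split_ifs <;> ring
    refine (runs_locate_move_scan hA hn hB h4 h5 (w := w) (fun c => rfl) himg h71'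
      (hk.trans hv.symm) hq (κ := -1 * γ) (by rw [h72])
      (heq ▸ hw.awayStep hv1 hls.1)).mono le_rfl fun υ ⟨hrep, hwυ⟩ => ⟨hrep, ?_⟩
    rw [hwυ, heq]
    exact Step.away p v γ hpmin hvmax hlt hls
  · -- a Frank-Wolfe step
    rw [← hFW, ← hAway] at hle
    set q := (vertex R p - point R w).ofLp ⬝ᵥ A.mulVec (vertex R p - point R w).ofLp with hq
    set γ := stepSize q (τ.arr 7 3) (τ.arr 7 4) with hγ
    have hls : IsLineSearch (quadObj A b) (point R w) (vertex R p - point R w) 1 γ := by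
      rw [hγ, h74]
      exact isLineSearch_stepSize hA hq (by rw [h73, ← hFW]) (by rw [h73, ← hFW]; exact hFW0)
        zero_le_one
    refine (runs_locate_move_scan hA hn hB h4 h5 (w := w) (fun c => rfl) himg h71'
      (hk.trans hp.symm) hq (κ := γ) (by rw [h72, one_mul])
      (hw.fwStep hls.1 p)).mono le_rfl fun υ ⟨hrep, hwυ⟩ => ⟨hrep, ?_⟩
    rw [hwυ]
    exact Step.frankWolfe p v γ hpmin hvmax hle hls

theorem runs_start_scan (hA : A.PosSemidef) (hn : 0 < n) :
    Runs (.seq start scan) (inputMem A b R ε) (700 * (n + 1)) fun τ =>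
      Rep A b R ε τ ∧ ∃ a, weightsOf n τ = Pi.single a 1 := by
  have hsym : ∀ i j, A i j = A j i := fun i j => by
    have h := hA.1.apply j i
    simpa using h
  have hbase : Base n ((inputMem A b R ε).arr 0) ((inputMem A b R ε).arr 1)
      ((inputMem A b R ε).arr 2) (inputMem A b R ε) := ⟨rfl, rfl, rfl, rfl⟩
  have hS : (inputMem A b R ε).arr 2 0 = R := by simp [inputMem]
  let a : Atom n := (⟨0, hn⟩, true)
  have hcode : code a = 0 := by simp [a, code]
  refine ((runs_start hbase rfl rfl).seq (U := 500 * (n + 1))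
    fun τ ⟨hB, h4, h5⟩ => ?_).mono (by omega) fun _ h => h
  have hwτ : weightsOf n τ = Pi.single a 1 := by
    ext c
    have hc : code c = 0 ↔ c = a := by rw [← hcode, code_injective.eq_iff]
    simp only [weightsOf, h4, Pi.single_apply, hc]
  refine (runs_scan_rep hn hB (hwτ ▸ isWeights_single a) (x := vertex R a)
    (by rw [hwτ, point_single]) fun i => ?_).mono le_rfl fun _ h => ⟨h.1, a, h.2.trans hwτ⟩
  have hrow := inputMem_matrix (A := A) (b := b) (R := R) (ε := ε) a.1 i
  simp only [a, zero_mul, zero_add] at hrow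
  rw [h5 i i.isLt, hS, hrow, mulVec_vertex, hsym]
  simp [a]

/-- The program follows a run of the algorithm, spending `O(n)` steps per iteration, and stops
when the run returns. -/
theorem exists_run (hA : A.PosSemidef) (hR : 0 < R) (hn : 0 < n) :
    ∃ w : ℕ → Atom n → ℝ, IsRun (quadObj A b) R w ∧
      ∀ t, ReturnsAt (quadObj A b) R ε w t → ∃ τ, ∃ T ≤ 3000 * n * (t + 2),
        Exec program (inputMem A b R ε) τ T ∧ output n τ = point R (w t) := by
  obtain ⟨σ₀, T₀, hexec₀, hT₀, hrep₀, a, ha⟩ :=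
    runs_start_scan (A := A) (b := b) (R := R) (ε := ε) hA hn
  -- an infinite sequence of memories; the machine itself visits them until the test succeeds
  choose next T hexec hT hrep hstep using
    fun σ : {σ // Rep A b R ε σ} => σ.2.runs_iteration hA hR hn
  let σ : ℕ → {σ // Rep A b R ε σ} := fun k =>
    (fun σ => (⟨next σ, hrep σ⟩ : {σ // Rep A b R ε σ}))^[k] ⟨σ₀, hrep₀⟩
  have hsucc : ∀ k, (σ (k + 1)).1 = next (σ k) := fun k => by
    simp only [σ, Function.iterate_succ_apply']
  refine ⟨fun k => weightsOf n (σ k).1, ⟨⟨a, ha⟩, fun k => ?_⟩, fun t ht => ?_⟩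
  · have h := hstep (σ k)
    rw [← hsucc] at h
    exact h
  · obtain ⟨T', hT', hloop⟩ := exec_loop (U := 1400 * (n + 1)) (c := test) (p := iteration)
      (σ := fun k => (σ k).1) t
      (fun k hk => ((σ k).2.test_iff hA).2 (ht.2 k hk))
      (fun h => ((σ t).2.test_iff hA).1 h ht.1)
      (fun k => ⟨_, hT (σ k), by rw [hsucc]; exact hexec (σ k)⟩)
    refine ⟨(σ t).1, T₀ + T', ?_, hexec₀.seq hloop, (σ t).2.output⟩
    have hcost : test.cost = 8 := rfl
    rw [hcost] at hT'
    have h1 : 1400 * (n + 1) + 8 + 1 ≤ 3000 * n := by omega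
    have h2 : 700 * (n + 1) ≤ 3000 * n := by omega
    calc T₀ + T' ≤ 3000 * n + (t + 1) * (3000 * n) :=
          Nat.add_le_add (hT₀.trans h2) (hT'.trans (Nat.mul_le_mul_left _ h1))
      _ = 3000 * n * (t + 2) := by ring

end RealRAM.AFWProg

end

/-! ### The two bounds combined -/

theorem theorem2 :
    ∃ C : ℝ, 0 < C ∧
      -- the number of iterations
      (∀ (n s : ℕ) (R β₁ α₂ ε : ℝ) (f : EuclideanSpace ℝ (Fin n) → ℝ),
        0 < R → 0 < β₁ → 0 < α₂ → 0 < ε →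
        ConvexOn ℝ (L1Problem.l1Ball n R) f →
        (∀ x ∈ L1Problem.l1Ball n R, DifferentiableAt ℝ f x) →
        L1Problem.GradLipschitzL1 f R β₁ →
        L1Problem.QuadraticGrowthL2 f R α₂ →
        L1Problem.SparseBoundaryOptima f R s →
        ∀ w : ℕ → AFW.Atom n → ℝ, AFW.IsRun f R w →
          (∀ t : ℕ,
            C * max 1 (β₁ * s * max 1 (R ^ 2) / α₂) * max 1 (Real.log (β₁ * R ^ 2 / ε)) ≤ t →
            L1Problem.IsApproxOptimal f R ε (AFW.point R (w t))) ∧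
          ∃ t : ℕ,
            (t : ℝ) ≤
              C * max 1 (β₁ * s * max 1 (R ^ 2) / α₂) * max 1 (Real.log (β₁ * R ^ 2 / ε)) ∧
            AFW.ReturnsAt f R ε w t ∧
            L1Problem.IsApproxOptimal f R ε (AFW.point R (w t))) ∧
      -- the running time for quadratics
      ∃ P : RealRAM.Prog,
        ∀ (n s : ℕ) (R β₁ α₂ ε : ℝ) (A : Matrix (Fin n) (Fin n) ℝ) (b : Fin n → ℝ),
          0 < R → 0 < β₁ → 0 < α₂ → 0 < ε → A.PosSemidef →
          L1Problem.GradLipschitzL1 (L1Problem.quadObj A b) R β₁ →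
          L1Problem.QuadraticGrowthL2 (L1Problem.quadObj A b) R α₂ →
          L1Problem.SparseBoundaryOptima (L1Problem.quadObj A b) R s →
          ∃ (τ : RealRAM.Mem) (T : ℕ),
            RealRAM.Exec P (RealRAM.inputMem A b R ε) τ T ∧
            (T : ℝ) ≤ C * n * max 1 (β₁ * s * max 1 (R ^ 2) / α₂) *
              max 1 (Real.log (β₁ * R ^ 2 / ε)) ∧
            (∃ (w : ℕ → AFW.Atom n → ℝ) (t : ℕ),
              AFW.IsRun (L1Problem.quadObj A b) R w ∧
              AFW.ReturnsAt (L1Problem.quadObj A b) R ε w t ∧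
              RealRAM.output n τ = AFW.point R (w t)) ∧
            L1Problem.IsApproxOptimal (L1Problem.quadObj A b) R ε (RealRAM.output n τ) := by
  have hκ : ∀ (s : ℕ) (R β₁ α₂ : ℝ), 0 < β₁ → 0 < α₂ →
      β₁ * s / α₂ ≤ max 1 (β₁ * s * max 1 (R ^ 2) / α₂) := by
    intro s R β₁ α₂ hβ hα
    refine le_trans ?_ (le_max_right _ _)
    refine div_le_div_of_nonneg_right ?_ hα.le
    exact le_mul_of_one_le_right (by positivity) (le_max_left _ _)
  have hN : ∀ (s : ℕ) (R β₁ α₂ ε : ℝ), 1 ≤ max 1 (β₁ * s * max 1 (R ^ 2) / α₂) *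
      max 1 (Real.log (β₁ * R ^ 2 / ε)) := fun s R β₁ α₂ ε =>
    one_le_mul_of_one_le_of_one_le (le_max_left _ _) (le_max_left _ _)
  refine ⟨4000000, by norm_num, ?_, RealRAM.AFWProg.program, ?_⟩
  · intro n s R β₁ α₂ ε f hR hβ hα hε hconv hdiff hlip hqg hsparse w hrun
    obtain ⟨h1, t, ht, hret, hopt⟩ := hrun.iteration_bound (κ := _)
      ⟨hR, hβ, hα, hconv, hdiff, hlip, hqg, hsparse⟩ hε (le_max_left _ _) (hκ s R β₁ α₂ hβ hα)
    have hN' := hN s R β₁ α₂ ε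
    refine ⟨fun t ht => h1 t ?_, t, ?_, hret, hopt⟩
    · rw [mul_assoc] at ht
      linarith
    · rw [mul_assoc]
      linarith
  · intro n s R β₁ α₂ ε A b hR hβ hα hε hA hlip hqg hsparse
    have hP : AFW.SparseProblem (L1Problem.quadObj A b) R β₁ α₂ s :=
      ⟨hR, hβ, hα, L1Problem.convexOn_quadObj hA,
        fun x _ => (L1Problem.hasGradientAt_quadObj hA x).differentiableAt, hlip, hqg, hsparse⟩
    -- in dimension zero no point has the norm `R > 0` of a minimizer
    have hn : 0 < n := by
      obtain ⟨z, hz⟩ := hP.exists_isOptimal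
      rcases Nat.eq_zero_or_pos n with rfl | hn
      · have := (hsparse z hz).2
        simp only [L1Problem.l1norm, Finset.univ_eq_empty, Finset.sum_empty] at this
        linarith
      · exact hn
    obtain ⟨w, hrun, hexec⟩ := RealRAM.AFWProg.exists_run (b := b) (ε := ε) hA hR hn
    obtain ⟨-, t, ht, hret, hopt⟩ :=
      hrun.iteration_bound hP hε (le_max_left _ _) (hκ s R β₁ α₂ hβ hα)
    obtain ⟨τ, T, hT, hprog, hout⟩ := hexec t hret
    refine ⟨τ, T, hprog, ?_, ⟨w, t, hrun, hret, hout⟩, hout ▸ hopt⟩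
    have hN' := hN s R β₁ α₂ ε
    set N := max 1 (β₁ * s * max 1 (R ^ 2) / α₂) * max 1 (Real.log (β₁ * R ^ 2 / ε))
    have hT' : (T : ℝ) ≤ 3000 * n * (t + 2) := by exact_mod_cast hT
    calc (T : ℝ) ≤ 3000 * n * (t + 2) := hT'
      _ ≤ 3000 * n * (1002 * N) := by gcongr; linarith
      _ ≤ 4000000 * n * N := by
        have : 0 ≤ (n : ℝ) * N := by positivity
        linarith
      _ = _ := by rw [mul_assoc]; simp only [N, mul_assoc]
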